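/- Let $\mathcal X,\mathcal Y$ be finite non-empty alphabets, $W(y|x)$ a discrete memoryless channel, $q:\mathcal X\times\mathcal Y\to[0,\infty)$ a decoding metric, $Q\in\mathcal P(\mathcal X)$ an input distribution and $R\in\mathbb R$ a rate. Logarithms are natural, with $\log 0=-\infty$ and $0\cdot(-\infty)=0$; $[c]^+=\max\{0,c\}$; $D$ is relative entropy; $(Q\times W)(x,y)=Q(x)W(y|x)$. For functions $a_1,\dots,a_L:\mathcal X\to\mathbb R$ put $\phi_l=\mathbb E_Q[a_l(X)]$, let $\mathcal S$ be the set of $P_{XY}\in\mathcal P(\mathcal X\times\mathcal Y)$ with $\mathbb E_P[a_l(X)]=\phi_l$ for all $l$, and let $\mathcal T(P_{XY})$ be the set of $\tilde P_{XY}\in\mathcal S$ with $\tilde P_Y=P_Y$ and $\mathbb E_{\tilde P}[\log q(X,Y)]\ge\mathbb E_P[\log q(X,Y)]$. The exponent of the cost-constrained ensemble is $$E_r^{\mathrm{cost}}(Q,R,\{a_l\})=\min_{P_{XY}\in\mathcal S}\ \min_{\tilde P_{XY}\in\mathcal T(P_{XY})} D(P_{XY}\|Q\times W)+\big[D(\tilde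 P_{XY}\|Q\times P_Y)-R\big]^+ ,$$ and the exponent $E_r^{\mathrm{cc}}(Q,R)$ of the constant-composition ensemble is $E_r^{\mathrm{cost}}$ with the $|\mathcal X|$ costs $a_l(x)=\mathbf 1\{x=l\}$, $l\in\mathcal X$ (so that the constraints read $P_X=\tilde P_X=Q$). For a single cost $a_1$ let $$E_r^{\mathrm{cost}'}(Q,R,a_1)=\max_{\rho\in[0,1]}\ \sup_{s\ge0}\ -\log\mathbb E\Big[\Big(\frac{\mathbb E[q(\bar X,Y)^se^{a_1(\bar X)}\,|\,Y]}{q(X,Y)^se^{a_1(X)}}\Big)^{\rho}\Big]-\rho R,\qquad (X,Y,\bar X)\sim Q(x)W(y|x)Q(\bar x),$$ where the fraction is $+\infty$ whenever its denominator is $0$ (with $0^0=1$), and let $E_r^{\mathrm{iid}}(Q,R)=E_r^{\mathrm{cost}'}(Q,R,0)$, the exponent of the i.i.d. ensemble. 1. For any decoding metric $q$, $$\sup_{a_1,a_2}E_r^{\mathrm{cost}}(Q,R,\{a_1,a_2\})=E_r^{\mathrm{cc}}(Q,R)\quad\text{for every }Q,$$ $$\max_Q\sup_{a_1}E_r^{\mathrm{cost}'}(Q,R,a_1)=\max_QE_r^{\mathrm{cc}}(Q,R).$$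 2. If $q(x,y)=W(y|x)$ (maximum-likelihood decoding), then for every $Q$ $$\sup_{a_1}E_r^{\mathrm{cost}}(Q,R,a_1)=E_r^{\mathrm{cc}}(Q,R),\qquad \sup_{a_1}E_r^{\mathrm{cost}'}(Q,R,a_1)=E_r^{\mathrm{iid}}(Q,R),$$ and moreover $\max_QE_r^{\mathrm{iid}}(Q,R)=\max_QE_r^{\mathrm{cc}}(Q,R)$. The suprema are over all real-valued functions on $\mathcal X$, and the maxima over $Q\in\mathcal P(\mathcal X)$ are attained. -/

import Mathlib

open scoped ENNReal

namespace MismatchedDecoding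

noncomputable section

variable {X Y Z ι : Type*} [Fintype X] [Fintype Y] [Fintype Z]

/-- Relative entropy `D(P ‖ N) = ∑ z, P z * log (P z / N z)` of distributions on a finite alphabet,
with value `⊤` unless `P` is absolutely continuous with respect to `N`. -/
def relEntropy (P N : Z → ℝ) : EReal :=
  open Classical in
  if ∀ z, N z = 0 → P z = 0 then ((∑ z, P z * Real.log (P z / N z) : ℝ) : EReal) else ⊤

/-- `E_P[log q]`, where `log 0 = -∞` and `0 * (-∞) = 0`. -/
def expLog (P q : Z → ℝ) : EReal :=
  open Classical in
  if ∃ z, P z ≠ 0 ∧ q z = 0 then ⊥ else ((∑ z, P z * Real.log (q z) : ℝ) : EReal)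

/-- The `Y`-marginal of a joint distribution. -/
def margY (P : X × Y → ℝ) (y : Y) : ℝ := ∑ x, P (x, y)

/-- The joint distribution `(Q × W)(x, y) = Q x * W x y`. -/
def joint (Q : X → ℝ) (W : X → Y → ℝ) (z : X × Y) : ℝ := Q z.1 * W z.1 z.2

/-- The product distribution `(Q × N)(x, y) = Q x * N y`. -/
def prodDist (Q : X → ℝ) (N : Y → ℝ) (z : X × Y) : ℝ := Q z.1 * N z.2

/-- The joint distributions `P` on `X × Y` with `E_P[a_l(X)] = E_Q[a_l(X)]` for all `l`. -/
def setS (Y : Type*) [Fintype Y] (Q : X → ℝ) (a : ι → X → ℝ) : Set (X × Y → ℝ) :=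
  {P | P ∈ stdSimplex ℝ (X × Y) ∧ ∀ l, ∑ z, P z * a l z.1 = ∑ x, Q x * a l x}

/-- The joint distributions `P'` on `X × Y` with `E_{P'}[a_l(X)] = E_Q[a_l(X)]` for all `l`,
`P'_Y = P_Y` and `E_{P'}[log q(X,Y)] ≥ E_P[log q(X,Y)]`. -/
def setT (q : X → Y → ℝ) (Q : X → ℝ) (a : ι → X → ℝ) (P : X × Y → ℝ) : Set (X × Y → ℝ) :=
  {P' | P' ∈ setS Y Q a ∧ margY P' = margY P ∧
    expLog P (fun z => q z.1 z.2) ≤ expLog P' (fun z => q z.1 z.2)}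

/-- The error exponent of the cost-constrained ensemble with costs `a_l`, `l : ι`:
the minimum over `P ∈ S` and `P' ∈ T(P)` of `D(P ‖ Q × W) + [D(P' ‖ Q × P_Y) - R]⁺`. -/
def ErCost (W q : X → Y → ℝ) (Q : X → ℝ) (R : ℝ) (a : ι → X → ℝ) : EReal :=
  ⨅ P ∈ setS Y Q a, ⨅ P' ∈ setT q Q a P,
    relEntropy P (joint Q W) + max 0 (relEntropy P' (prodDist Q (margY P)) - (R : EReal))

/-- The error exponent of the constant-composition ensemble: the cost-constrained exponent
with one cost `a_l(x) = 1{x = l}` for each input letter `l`. -/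
def ErCC (W q : X → Y → ℝ) (Q : X → ℝ) (R : ℝ) : EReal :=
  ErCost W q Q R (fun l : X => Set.indicator {l} 1)

/-- `E[q(X̄,y)^s e^{a(X̄)}] / (q(x,y)^s e^{a(x)})` with `X̄ ∼ Q`. A vanishing denominator gives the
value `⊤`, also when the numerator vanishes: a transmitted letter of metric zero can never be
strictly preferred by the decoder. -/
def tiltedRatio (q : X → Y → ℝ) (Q : X → ℝ) (s : ℝ) (a : X → ℝ) (x : X) (y : Y) : ℝ≥0∞ :=
  open Classical in
  if q x y ^ s = 0 then ⊤
  else ENNReal.ofReal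
    ((∑ x', Q x' * (q x' y ^ s * Real.exp (a x'))) / (q x y ^ s * Real.exp (a x)))

/-- `-log E[(E[q(X̄,Y)^s e^{a(X̄)} | Y] / (q(X,Y)^s e^{a(X)}))^ρ]` with `(X, Y) ∼ Q × W`. -/
def E0Obj (W q : X → Y → ℝ) (Q : X → ℝ) (ρ s : ℝ) (a : X → ℝ) : EReal :=
  -ENNReal.log (∑ x, ∑ y, ENNReal.ofReal (Q x * W x y) * tiltedRatio q Q s a x y ^ ρ)

/-- The function `E_0^{cost'}`. -/
def E0CostPrime (W q : X → Y → ℝ) (Q : X → ℝ) (ρ : ℝ) (a : X → ℝ) : EReal :=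
  ⨆ s ∈ Set.Ici (0 : ℝ), E0Obj W q Q ρ s a

/-- The weaker exponent `E_r^{cost'}` of the cost-constrained ensemble with one cost. -/
def ErCostPrime (W q : X → Y → ℝ) (Q : X → ℝ) (R : ℝ) (a : X → ℝ) : EReal :=
  ⨆ ρ ∈ Set.Icc (0 : ℝ) 1, E0CostPrime W q Q ρ a - ((ρ * R : ℝ) : EReal)

/-- The function `E_0^{iid}`: no exponential tilting. -/
def E0Iid (W q : X → Y → ℝ) (Q : X → ℝ) (ρ : ℝ) : EReal :=
  ⨆ s ∈ Set.Ici (0 : ℝ), E0Obj W q Q ρ s 0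

/-- The error exponent of the i.i.d. ensemble. -/
def ErIid (W q : X → Y → ℝ) (Q : X → ℝ) (R : ℝ) : EReal :=
  ⨆ ρ ∈ Set.Icc (0 : ℝ) 1, E0Iid W q Q ρ - ((ρ * R : ℝ) : EReal)

end

end MismatchedDecoding

open MismatchedDecoding

/-! All equalities come from Lagrange duality for the convex program behind the constant-composition
exponent: minimize D(P‖Q×W) + [D(P'‖Q×P_Y) − R]⁺ over pairs with equal Y-marginals, subject to P_X =
P'_X = Q and the metric inequality, which is linear in (P, P'). Writing [x]⁺ as the supremum of ρx
over ρ ∈ [0,1] turns the program into a Lagrangian with multipliers ρ, s and functions on the input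
alphabet (`exists_lagrange_multipliers`). Adding costs only enlarges a feasible set that contains
the constant-composition one, so the content lies in the lower bounds.

Two costs: the multipliers of P_X = Q and P'_X = Q are themselves the costs, because the cost
constraints make exactly those linear terms vanish. Under maximum likelihood the Lagrangian with s =
ρ/(1+ρ) is a convex combination of its values on the diagonal pairs (P, P) and (P', P')
(`klSum_add_sub_logGap_eq`), so one constraint P_X = Q, hence one cost, is enough.

The exponent with a single tilt a is the dual of the program in which P_X = P'_X = Q is weakened to
P_X = P'_X. Its Lagrangian has an explicit minimizer (`lagrangian_tiltedDist`), and weak duality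
(`E0Obj_le`) holds for every Q. The relaxation is generally lossy, but not at a maximizer Q of the
constant-composition exponent (`ErCC_le_costObjReal_of_isMaxOn`): a better pair with marginal Q₁
would force the exponent to increase to first order when Q moves away from Q₁, while changing the
reference distribution costs only second order. A maximizer exists by upper semicontinuity. For
maximum likelihood the minimizer with s = 1/(1+ρ) and no tilt lies on the diagonal, where weak
duality bounds every other (s, a), so tilting gains nothing.

If q vanishes at a transition of positive probability, the constant-composition exponent is at most
[−R]⁺, a value attained with zero costs. -/

namespace MismatchedDecoding

/-! ### Lagrange duality -/

/-- Lagrange duality with an exact penalty `max 0 f₁`: a strict lower bound on the constrained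
problem is a strict lower bound on some Lagrangian, with strictly positive multipliers for the
inequality constraint and for `f₁`. -/
theorem exists_lagrange_multipliers {E ι : Type*} [AddCommGroup E] [Module ℝ E]
    [TopologicalSpace E] [IsTopologicalAddGroup E] [ContinuousSMul ℝ E] [Fintype ι]
    {K : Set E} (hK : IsCompact K) (hKc : Convex ℝ K) {f₀ f₁ : E → ℝ}
    (hf₀ : ContinuousOn f₀ K) (hf₁ : ContinuousOn f₁ K)
    (hf₀' : ConvexOn ℝ K f₀) (hf₁' : ConvexOn ℝ K f₁)
    (h : E →L[ℝ] ℝ) (G : E →L[ℝ] (ι → ℝ)) (b : ι → ℝ) {c : ℝ}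
    (hc : ∀ k ∈ K, 0 ≤ h k → G k = b → c < f₀ k + max 0 (f₁ k)) :
    ∃ ρ s : ℝ, ∃ l : ι → ℝ, 0 < ρ ∧ ρ ≤ 1 ∧ 0 < s ∧
      ∀ k ∈ K, c < f₀ k + ρ * f₁ k - s * h k + ∑ i, l i * (G k i - b i) := by
  rcases K.eq_empty_or_nonempty with rfl | hne
  · exact ⟨1, 1, 0, by simp⟩
  -- Excluding ρ = 0 and s = 0 costs nothing for a strict bound; the tilt later needs division by ρ
  -- and a positive power of q.
  let Λ : Set (ℝ × ℝ × (ι → ℝ)) := {y | 0 < y.1 ∧ y.1 ≤ 1 ∧ 0 < y.2.1}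
  let f : E → ℝ × ℝ × (ι → ℝ) → ℝ := fun k y =>
    f₀ k + y.1 * f₁ k - y.2.1 * h k + ∑ i, y.2.2 i * (G k i - b i)
  have hΛ : Convex ℝ Λ := by
    rintro ⟨a, b, g⟩ ⟨h1, h2, h3⟩ ⟨a', b', g'⟩ ⟨h1', h2', h3'⟩ s t hs ht hst
    simp only [Λ, Set.mem_ofPred_eq, Prod.smul_mk, Prod.mk_add_mk, smul_eq_mul] at *
    refine ⟨?_, by nlinarith, ?_⟩
    · rcases hs.eq_or_lt with rfl | hs
      · obtain rfl : t = 1 := by linarith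
        simpa
      · have := mul_pos hs h1
        have := mul_nonneg ht h1'.le
        linarith
    · rcases hs.eq_or_lt with rfl | hs
      · obtain rfl : t = 1 := by linarith
        simpa
      · have := mul_pos hs h3
        have := mul_nonneg ht h3'.le
        linarith
  have hfy : ∀ y ∈ Λ, ContinuousOn (fun k => f k y) K := by
    intro y _
    have : Continuous fun k => ∑ i, y.2.2 i * (G k i - b i) := by fun_prop
    exact ((hf₀.add (continuousOn_const.mul hf₁)).sub
      (continuousOn_const.mul h.continuous.continuousOn)).add this.continuousOn
  have hfyc : ∀ y ∈ Λ, ConvexOn ℝ K (fun k => f k y) := by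
    intro y hy
    refine ⟨hKc, fun k hk k' hk' s t hs ht hst => ?_⟩
    have h0 := hf₀'.2 hk hk' hs ht hst
    have h1 := mul_le_mul_of_nonneg_left (hf₁'.2 hk hk' hs ht hst) hy.1.le
    have h2 : ∑ i, y.2.2 i * (G (s • k + t • k') i - b i)
        = s * ∑ i, y.2.2 i * (G k i - b i) + t * ∑ i, y.2.2 i * (G k' i - b i) := by
      rw [Finset.mul_sum, Finset.mul_sum, ← Finset.sum_add_distrib]
      refine Finset.sum_congr rfl fun i _ => ?_
      simp only [map_add, map_smul, Pi.add_apply, Pi.smul_apply, smul_eq_mul]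
      linear_combination y.2.2 i * b i * hst
    simp only [f, map_add, map_smul, smul_eq_mul] at *
    linarith
  have hfx : ∀ k ∈ K, UpperSemicontinuousOn (fun y => f k y) Λ := by
    intro k _
    have : Continuous fun y => f k y := by fun_prop
    exact this.continuousOn.upperSemicontinuousOn
  have hfxc : ∀ k ∈ K, QuasiconcaveOn ℝ Λ (fun y => f k y) := by
    intro k _
    refine ConcaveOn.quasiconcaveOn ⟨hΛ, fun y _ y' _ s t hs ht hst => le_of_eq ?_⟩
    simp only [f, smul_eq_mul, Prod.fst_add, Prod.snd_add, Prod.smul_fst, Prod.smul_snd,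
      Pi.add_apply, Pi.smul_apply, add_mul, Finset.sum_add_distrib, mul_add, Finset.mul_sum]
    simp only [mul_assoc]
    linear_combination f₀ k * hst
  -- Pointwise, the supremum of the Lagrangian over the multipliers exceeds `c`: a violated
  -- constraint is penalized until it does, and at a feasible point the slack in `hc` absorbs small
  -- ρ and s.
  have hpt : ∀ k ∈ K, ∃ y ∈ Λ, c < f k y := by
    intro k hk
    by_cases hG : G k = b
    · rcases lt_or_ge (h k) 0 with hh | hh
      · refine ⟨(1, (|c - f₀ k - f₁ k| + 1) / (-h k), 0), ⟨one_pos, le_rfl, ?_⟩, ?_⟩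
        · exact div_pos (by positivity) (by linarith)
        · have : (|c - f₀ k - f₁ k| + 1) / (-h k) * h k = -(|c - f₀ k - f₁ k| + 1) := by
            field_simp [hh.ne]
          simp only [f, this]
          have := le_abs_self (c - f₀ k - f₁ k)
          simp
          linarith
      · have hlt := hc k hk hh hG
        set d := f₀ k + max 0 (f₁ k) - c with hd
        have hd0 : 0 < d := by linarith
        -- The slack d is split: less than d/2 is lost in approximating `max 0 (f₁ k)` by a positive
        -- ρ, and at most d/4 in the term with s.
        obtain ⟨ρ, hρ, hρ1, hρ2⟩ : ∃ ρ : ℝ, 0 < ρ ∧ ρ ≤ 1 ∧ max 0 (f₁ k) - d / 2 < ρ * f₁ k := by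
          rcases le_total 0 (f₁ k) with h1 | h1
          · exact ⟨1, one_pos, le_rfl, by rw [max_eq_right h1]; linarith⟩
          · refine ⟨min 1 (d / 4 / (1 - f₁ k)), ?_, min_le_left _ _, ?_⟩
            · exact lt_min one_pos (div_pos (by linarith) (by linarith))
            · rw [max_eq_left h1]
              have h2 : min 1 (d / 4 / (1 - f₁ k)) * (1 - f₁ k) ≤ d / 4 := by
                rw [← le_div_iff₀ (by linarith)]
                exact min_le_right _ _
              have h3 : 0 < min 1 (d / 4 / (1 - f₁ k)) :=
                lt_min one_pos (div_pos (by linarith) (by linarith))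
              linarith
        have hs : d / 4 / (1 + h k) * h k ≤ d / 4 := by
          rw [div_mul_eq_mul_div, div_le_iff₀ (by linarith)]
          nlinarith
        refine ⟨(ρ, d / 4 / (1 + h k), 0), ⟨hρ, hρ1, by
          exact div_pos (by linarith) (by linarith)⟩, ?_⟩
        simp only [f, Pi.zero_apply, zero_mul, Finset.sum_const_zero]
        linarith
    · set e := ∑ i, (G k i - b i) * (G k i - b i) with he
      have he0 : 0 < e := by
        obtain ⟨i, hi⟩ := Function.ne_iff.mp hG
        refine Finset.sum_pos' (fun i _ => mul_self_nonneg _) ⟨i, Finset.mem_univ _, ?_⟩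
        exact mul_self_pos.mpr (sub_ne_zero.mpr hi)
      -- A multiplier along the residual G k − b contributes a positive multiple of its squared norm
      -- e.
      refine ⟨(1, 1, fun i => (|c - f₀ k - f₁ k + h k| + 1) / e * (G k i - b i)),
        ⟨one_pos, le_rfl, one_pos⟩, ?_⟩
      have : ∑ i, (|c - f₀ k - f₁ k + h k| + 1) / e * (G k i - b i) * (G k i - b i)
          = |c - f₀ k - f₁ k + h k| + 1 := by
        simp only [mul_assoc]
        rw [← Finset.mul_sum, ← he, div_mul_cancel₀ _ he0.ne']
      simp only [f, this]
      have := le_abs_self (c - f₀ k - f₁ k + h k)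
      linarith
  have hlsc : ∀ y ∈ Λ, LowerSemicontinuousOn (fun k => f k y) K :=
    fun y hy => (hfy y hy).lowerSemicontinuousOn
  -- The multiplier set is not compact; compactness of K reduces it to finitely many multipliers
  -- before Sion's minimax theorem is applied.
  have hfin : ∃ s : Finset Λ, ∀ x ∈ K, ∃ i ∈ s, c < f x i := by
    rw [← LowerSemicontinuousOn.inter_biInter_preimage_Iic_eq_empty_iff_exists_finset hK hlsc]
    apply Set.eq_empty_of_forall_notMem
    rintro x ⟨hx, hx'⟩
    obtain ⟨y, hy, hlt⟩ := hpt x hx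
    simp only [Set.mem_iInter, Set.mem_preimage, Set.mem_Iic] at hx'
    exact hlt.not_ge (hx' y hy)
  obtain ⟨s, hs⟩ := hfin
  obtain ⟨y, hy, hlt⟩ := Sion.exists_lt_iInf_of_lt_iInf_of_finite hne hK hlsc
    (fun y hy => (hfyc y hy).quasiconvexOn) hΛ hfx hfxc hKc (t := c)
    (Set.toFinite (Subtype.val '' (s : Set Λ))) (Subtype.coe_image_subset Λ s) (by
      intro x hx
      obtain ⟨i, hi, hi'⟩ := hs x hx
      exact ⟨i, ⟨i, hi, rfl⟩, hi'⟩)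
  exact ⟨y.1, y.2.1, y.2.2, hy.1, hy.2.1, hy.2.2, hlt⟩

end MismatchedDecoding

/-! ### Relative entropy and marginals -/

namespace MismatchedDecoding

set_option linter.unusedSectionVars false

noncomputable section

variable {X Y Z : Type*} [Fintype X] [Fintype Y] [Fintype Z]

/-- The real-valued relative entropy, meaningful when `P` is absolutely continuous with respect
to `N`. -/
def klSum (P N : Z → ℝ) : ℝ := ∑ z, P z * Real.log (P z / N z)

/-- The `X`-marginal of a joint distribution. -/
def margX (P : X × Y → ℝ) (x : X) : ℝ := ∑ y, P (x, y)

theorem relEntropy_eq_klSum {P N : Z → ℝ} (h : ∀ z, N z = 0 → P z = 0) :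
    relEntropy P N = (klSum P N : EReal) := by
  simp [relEntropy, klSum, if_pos h]

theorem relEntropy_eq_top {P N : Z → ℝ} (h : ¬ ∀ z, N z = 0 → P z = 0) :
    relEntropy P N = ⊤ := by
  rw [relEntropy, if_neg h]

theorem expLog_eq_bot {P q : Z → ℝ} (h : ∃ z, P z ≠ 0 ∧ q z = 0) : expLog P q = ⊥ := by
  rw [expLog, if_pos h]

theorem expLog_eq_coe {P q : Z → ℝ} (h : ∀ z, q z = 0 → P z = 0) :
    expLog P q = ((∑ z, P z * Real.log (q z) : ℝ) : EReal) := by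
  rw [expLog, if_neg]
  rintro ⟨z, hz, hq⟩
  exact hz (h z hq)

theorem sub_le_mul_log_div {a b : ℝ} (ha : 0 ≤ a) (hb : 0 ≤ b) (hab : b = 0 → a = 0) :
    a - b ≤ a * Real.log (a / b) := by
  rcases ha.eq_or_lt with rfl | ha
  · simpa using hb
  have hb : 0 < b := hb.lt_of_ne fun h => ha.ne' (hab h.symm)
  have h1 := Real.log_le_sub_one_of_pos (div_pos hb ha)
  have h2 : Real.log (a / b) = -Real.log (b / a) := by rw [← Real.log_inv, inv_div]
  have h3 := mul_le_mul_of_nonneg_left h1 ha.le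
  have h4 : a * (b / a - 1) = b - a := by field_simp
  rw [h2]
  linarith

theorem sum_sub_sum_le_klSum {P M : Z → ℝ} (hP : ∀ z, 0 ≤ P z) (hM : ∀ z, 0 ≤ M z)
    (h : ∀ z, M z = 0 → P z = 0) : ∑ z, P z - ∑ z, M z ≤ klSum P M := by
  rw [klSum, ← Finset.sum_sub_distrib]
  exact Finset.sum_le_sum fun z _ => sub_le_mul_log_div (hP z) (hM z) (h z)

theorem klSum_nonneg {P M : Z → ℝ} (hP : P ∈ stdSimplex ℝ Z) (hM : M ∈ stdSimplex ℝ Z)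
    (h : ∀ z, M z = 0 → P z = 0) : 0 ≤ klSum P M := by
  have := sum_sub_sum_le_klSum hP.1 hM.1 h
  rwa [hP.2, hM.2, sub_self] at this

/-- Gibbs variational bound: normalizing M shifts the divergence by the log of its mass and leaves a
nonnegative relative entropy. -/
theorem neg_log_sum_le_klSum {P M : Z → ℝ} (hP : P ∈ stdSimplex ℝ Z) (hM : ∀ z, 0 ≤ M z)
    (h : ∀ z, M z = 0 → P z = 0) : -Real.log (∑ z, M z) ≤ klSum P M := by
  have hS : 0 < ∑ z, M z := by
    refine (Finset.sum_nonneg fun z _ => hM z).lt_of_ne fun h0 => ?_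
    rw [eq_comm, Finset.sum_eq_zero_iff_of_nonneg fun z _ => hM z] at h0
    have : ∑ z, P z = 0 := Finset.sum_eq_zero fun z hz => h z (h0 z hz)
    linarith [hP.2]
  have h1 := sum_sub_sum_le_klSum (M := fun z => M z / ∑ z, M z) hP.1
    (fun z => div_nonneg (hM z) hS.le) fun z hz => h z (by
      rcases div_eq_zero_iff.mp hz with h | h
      · exact h
      · exact absurd h hS.ne')
  rw [← Finset.sum_div, div_self hS.ne', hP.2, sub_self] at h1
  have h2 : klSum P (fun z => M z / ∑ z, M z) = klSum P M + Real.log (∑ z, M z) := by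
    rw [klSum, klSum, ← one_mul (Real.log (∑ z, M z)), ← hP.2, Finset.sum_mul,
      ← Finset.sum_add_distrib]
    refine Finset.sum_congr rfl fun z _ => ?_
    by_cases hz : P z = 0
    · simp [hz]
    have hm : M z ≠ 0 := fun h0 => hz (h z h0)
    rw [← mul_add, ← Real.log_mul (div_ne_zero hz hm) hS.ne']
    congr 2
    field_simp
  linarith

@[simp]
theorem klSum_self (P : Z → ℝ) : klSum P P = 0 := by
  refine Finset.sum_eq_zero fun z _ => ?_
  by_cases hz : P z = 0
  · simp [hz]
  · simp [div_self hz]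

/-- Joint convexity, termwise: p log(p/n) lies above its tangent p log r + p − nr, and taking r to
be the ratio of the mixtures makes the two tangent bounds add up to the mixed term. -/
theorem klSum_add_le {P₁ P₂ N₁ N₂ : Z → ℝ} (hP₁ : ∀ z, 0 ≤ P₁ z) (hP₂ : ∀ z, 0 ≤ P₂ z)
    (hN₁ : ∀ z, 0 ≤ N₁ z) (hN₂ : ∀ z, 0 ≤ N₂ z) (h₁ : ∀ z, N₁ z = 0 → P₁ z = 0)
    (h₂ : ∀ z, N₂ z = 0 → P₂ z = 0) {s t : ℝ} (hs : 0 ≤ s) (ht : 0 ≤ t) :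
    klSum (s • P₁ + t • P₂) (s • N₁ + t • N₂) ≤ s * klSum P₁ N₁ + t * klSum P₂ N₂ := by
  rw [klSum, klSum, klSum, Finset.mul_sum, Finset.mul_sum, ← Finset.sum_add_distrib]
  refine Finset.sum_le_sum fun z _ => ?_
  simp only [Pi.add_apply, Pi.smul_apply, smul_eq_mul]
  have key : ∀ {w p n r : ℝ}, 0 ≤ w → 0 ≤ p → 0 ≤ n → (n = 0 → p = 0) → 0 < r →
      w * (p * Real.log r + p - n * r) ≤ w * (p * Real.log (p / n)) := by
    intro w p n r hw hp hn hpn hr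
    refine mul_le_mul_of_nonneg_left ?_ hw
    have h := sub_le_mul_log_div hp (mul_nonneg hn hr.le) (by
      intro h; exact hpn ((mul_eq_zero.mp h).resolve_right hr.ne'))
    rcases hp.eq_or_lt with rfl | hp
    · simp at h ⊢; linarith
    have hn' : n ≠ 0 := fun h => hp.ne' (hpn h)
    have : Real.log (p / (n * r)) = Real.log (p / n) - Real.log r := by
      rw [← div_div, Real.log_div (div_ne_zero hp.ne' hn') hr.ne']
    rw [this] at h
    linarith
  rcases (add_nonneg (mul_nonneg hs (hP₁ z)) (mul_nonneg ht (hP₂ z))).eq_or_lt with h0 | h0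
  · have e1 : s * P₁ z = 0 := by linarith [mul_nonneg hs (hP₁ z), mul_nonneg ht (hP₂ z)]
    have e2 : t * P₂ z = 0 := by linarith [mul_nonneg hs (hP₁ z), mul_nonneg ht (hP₂ z)]
    rw [← mul_assoc, ← mul_assoc, e1, e2]
    simp
  have hn : 0 < s * N₁ z + t * N₂ z := by
    refine (add_nonneg (mul_nonneg hs (hN₁ z)) (mul_nonneg ht (hN₂ z))).lt_of_ne fun h => ?_
    have e1 : s * N₁ z = 0 := by linarith [mul_nonneg hs (hN₁ z), mul_nonneg ht (hN₂ z)]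
    have e2 : t * N₂ z = 0 := by linarith [mul_nonneg hs (hN₁ z), mul_nonneg ht (hN₂ z)]
    have e3 : s * P₁ z = 0 := by
      rcases mul_eq_zero.mp e1 with h | h <;> simp [h, h₁ z]
    have e4 : t * P₂ z = 0 := by
      rcases mul_eq_zero.mp e2 with h | h <;> simp [h, h₂ z]
    linarith
  set r := (s * P₁ z + t * P₂ z) / (s * N₁ z + t * N₂ z) with hr
  have hr0 : 0 < r := div_pos h0 hn
  have k1 := key hs (hP₁ z) (hN₁ z) (h₁ z) hr0
  have k2 := key ht (hP₂ z) (hN₂ z) (h₂ z) hr0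
  have hrn : (s * N₁ z + t * N₂ z) * r = s * P₁ z + t * P₂ z := by
    rw [hr]; field_simp
  linarith

/-- Where N vanishes the summand is identically 0, since division by zero and `Real.log 0` return 0;
elsewhere it is a rescaled t log t. -/
theorem continuous_klSum_left (N : Z → ℝ) : Continuous fun P : Z → ℝ => klSum P N := by
  refine continuous_finsetSum _ fun z _ => ?_
  by_cases hz : N z = 0
  · simp [hz, continuous_const]
  have : ∀ P : Z → ℝ, P z * Real.log (P z / N z)
      = N z * (P z / N z * Real.log (P z / N z)) := fun P => by
    field_simp
  simp only [this]
  have hc : Continuous fun P : Z → ℝ => P z / N z := by fun_prop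
  exact continuous_const.mul (Real.continuous_mul_log.comp hc)

theorem joint_mem_stdSimplex {Q : X → ℝ} {W : X → Y → ℝ} (hQ : Q ∈ stdSimplex ℝ X)
    (hW : ∀ x, W x ∈ stdSimplex ℝ Y) : joint Q W ∈ stdSimplex ℝ (X × Y) := by
  refine ⟨fun z => mul_nonneg (hQ.1 _) ((hW _).1 _), ?_⟩
  simp only [joint, Fintype.sum_prod_type, ← Finset.mul_sum, (hW _).2, mul_one, hQ.2]

theorem margX_joint {Q : X → ℝ} {W : X → Y → ℝ} (hW : ∀ x, W x ∈ stdSimplex ℝ Y) :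
    margX (joint Q W) = Q := by
  ext x
  simp only [margX, joint, ← Finset.mul_sum, (hW _).2, mul_one]

theorem margX_mem_stdSimplex {P : X × Y → ℝ} (hP : P ∈ stdSimplex ℝ (X × Y)) :
    margX P ∈ stdSimplex ℝ X :=
  ⟨fun x => Finset.sum_nonneg fun y _ => hP.1 _, by
    rw [← hP.2, Fintype.sum_prod_type]; rfl⟩

theorem margY_mem_stdSimplex {P : X × Y → ℝ} (hP : P ∈ stdSimplex ℝ (X × Y)) :
    margY P ∈ stdSimplex ℝ Y :=
  ⟨fun x => Finset.sum_nonneg fun y _ => hP.1 _, by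
    rw [← hP.2, Fintype.sum_prod_type_right]; rfl⟩

theorem eq_zero_of_margX_eq_zero {P : X × Y → ℝ} (hP : ∀ z, 0 ≤ P z) {z : X × Y}
    (h : margX P z.1 = 0) : P z = 0 :=
  (Finset.sum_eq_zero_iff_of_nonneg fun y _ => hP (z.1, y)).mp h z.2 (Finset.mem_univ _)

theorem eq_zero_of_margY_eq_zero {P : X × Y → ℝ} (hP : ∀ z, 0 ≤ P z) {z : X × Y}
    (h : margY P z.2 = 0) : P z = 0 :=
  (Finset.sum_eq_zero_iff_of_nonneg fun x _ => hP (x, z.2)).mp h z.1 (Finset.mem_univ _)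

theorem sum_mul_fst (P : X × Y → ℝ) (f : X → ℝ) :
    ∑ z, P z * f z.1 = ∑ x, margX P x * f x := by
  simp only [Fintype.sum_prod_type, margX, Finset.sum_mul]

theorem sum_mul_snd (P : X × Y → ℝ) (f : Y → ℝ) :
    ∑ z, P z * f z.2 = ∑ y, margY P y * f y := by
  simp only [Fintype.sum_prod_type_right, margY, Finset.sum_mul]

/-- Changing the reference input distribution in the relative entropy of a joint distribution. -/
theorem klSum_joint_eq_add {P : X × Y → ℝ} {Q : X → ℝ} {W : X → Y → ℝ} (hP : ∀ z, 0 ≤ P z)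
    (h : ∀ z, joint Q W z = 0 → P z = 0) :
    klSum P (joint Q W) = klSum P (joint (margX P) W) + klSum (margX P) Q := by
  rw [klSum, klSum, klSum, ← sum_mul_fst, ← Finset.sum_add_distrib]
  refine Finset.sum_congr rfl fun z _ => ?_
  by_cases hz : P z = 0
  · simp [hz]
  have hj : Q z.1 * W z.1 z.2 ≠ 0 := fun h0 => hz (h z h0)
  have hq := left_ne_zero_of_mul hj
  have hw := right_ne_zero_of_mul hj
  have hm : margX P z.1 ≠ 0 := fun h0 => hz (eq_zero_of_margX_eq_zero hP h0)
  rw [← mul_add, joint, joint, ← Real.log_mul (by positivity) (by positivity)]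
  congr 2
  field_simp

/-- Separating the Y-entropy removes the moving reference P_Y from the logarithm; both the
continuity of the second divergence and the maximum-likelihood identity rest on this form. -/
theorem klSum_prodDist_margY {P : X × Y → ℝ} {Q : X → ℝ} (hP : ∀ z, 0 ≤ P z)
    (h : ∀ z : X × Y, Q z.1 = 0 → P z = 0) :
    klSum P (prodDist Q (margY P))
      = klSum P (fun z => Q z.1) - ∑ y, margY P y * Real.log (margY P y) := by
  rw [klSum, klSum, ← sum_mul_snd, ← Finset.sum_sub_distrib]
  refine Finset.sum_congr rfl fun z _ => ?_
  by_cases hz : P z = 0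
  · simp [hz]
  have hq : Q z.1 ≠ 0 := fun h0 => hz (h z h0)
  have hm : margY P z.2 ≠ 0 := fun h0 => hz (eq_zero_of_margY_eq_zero hP h0)
  rw [← mul_sub, prodDist, ← div_div, Real.log_div (div_ne_zero hz hq) hm]

theorem continuous_margY : Continuous (margY : (X × Y → ℝ) → Y → ℝ) :=
  continuous_pi fun y => by unfold margY; fun_prop

theorem continuous_margX : Continuous (margX : (X × Y → ℝ) → X → ℝ) :=
  continuous_pi fun y => by unfold margX; fun_prop

theorem margX_add_smul (s t : ℝ) (P P' : X × Y → ℝ) :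
    margX (s • P + t • P') = s • margX P + t • margX P' := by
  ext x
  simp [margX, Finset.sum_add_distrib, Finset.mul_sum]

theorem margY_add_smul (s t : ℝ) (P P' : X × Y → ℝ) :
    margY (s • P + t • P') = s • margY P + t • margY P' := by
  ext x
  simp [margY, Finset.sum_add_distrib, Finset.mul_sum]

theorem prodDist_eq_zero_imp {P : X × Y → ℝ} {Q : X → ℝ} (hP : ∀ z, 0 ≤ P z)
    (h : ∀ z : X × Y, Q z.1 = 0 → P z = 0) (z : X × Y) (hz : prodDist Q (margY P) z = 0) :
    P z = 0 := by
  rcases mul_eq_zero.mp hz with h0 | h0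
  · exact h z h0
  · exact eq_zero_of_margY_eq_zero hP h0

end

end MismatchedDecoding

/-! ### The exponents as convex programs -/

namespace MismatchedDecoding

set_option linter.unusedSectionVars false

noncomputable section

variable {X Y Z ι : Type*} [Fintype X] [Fintype Y] [Fintype Z]

/-- The objective `D(P ‖ Q × W) + [D(P' ‖ Q × P_Y) - R]⁺` of the cost-constrained exponent. -/
def costObj (W : X → Y → ℝ) (Q : X → ℝ) (R : ℝ) (P P' : X × Y → ℝ) : EReal :=
  relEntropy P (joint Q W) + max 0 (relEntropy P' (prodDist Q (margY P)) - (R : EReal))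

/-- The real-valued version of `costObj`. -/
def costObjReal (W : X → Y → ℝ) (Q : X → ℝ) (R : ℝ) (P P' : X × Y → ℝ) : ℝ :=
  klSum P (joint Q W) + max 0 (klSum P' (prodDist Q (margY P)) - R)

theorem costObj_eq_coe {W : X → Y → ℝ} {Q : X → ℝ} (R : ℝ) {P P' : X × Y → ℝ}
    (h : ∀ z, joint Q W z = 0 → P z = 0) (h' : ∀ z, prodDist Q (margY P) z = 0 → P' z = 0) :
    costObj W Q R P P' = (costObjReal W Q R P P' : EReal) := by
  rw [costObj, costObjReal, relEntropy_eq_klSum h, relEntropy_eq_klSum h']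
  norm_cast

theorem costObj_eq_top {W : X → Y → ℝ} {Q : X → ℝ} (R : ℝ) {P P' : X × Y → ℝ}
    (h : ¬((∀ z, joint Q W z = 0 → P z = 0) ∧ ∀ z, prodDist Q (margY P) z = 0 → P' z = 0)) :
    costObj W Q R P P' = ⊤ := by
  by_cases h1 : ∀ z, joint Q W z = 0 → P z = 0
  · have h2 : ¬ ∀ z, prodDist Q (margY P) z = 0 → P' z = 0 := fun h2 => h ⟨h1, h2⟩
    rw [costObj, relEntropy_eq_klSum h1, relEntropy_eq_top h2, EReal.top_sub_coe, max_eq_right le_top,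
      EReal.coe_add_top]
  · rw [costObj, relEntropy_eq_top h1]
    exact EReal.top_add_of_ne_bot (ne_of_gt (lt_of_lt_of_le (by simp) (le_max_left _ _)))

/-- The pairs over which the constant-composition exponent minimizes `costObj`. -/
def IsCCPair (q : X → Y → ℝ) (Q : X → ℝ) (P P' : X × Y → ℝ) : Prop :=
  P ∈ stdSimplex ℝ (X × Y) ∧ P' ∈ stdSimplex ℝ (X × Y) ∧ margX P = Q ∧ margX P' = Q ∧
    margY P' = margY P ∧ expLog P (fun z => q z.1 z.2) ≤ expLog P' (fun z => q z.1 z.2)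

theorem sum_mul_cost_eq {P : X × Y → ℝ} {Q : X → ℝ} (h : margX P = Q) (a : X → ℝ) :
    ∑ z, P z * a z.1 = ∑ x, Q x * a x := by
  rw [sum_mul_fst, h]

theorem mem_setS_indicator_iff {P : X × Y → ℝ} {Q : X → ℝ} :
    P ∈ setS Y Q (fun l : X => Set.indicator {l} 1) ↔
      P ∈ stdSimplex ℝ (X × Y) ∧ margX P = Q := by
  refine and_congr_right fun _ => ⟨fun h => ?_, fun h l => sum_mul_cost_eq h _⟩
  ext x
  classical
  have hx := h x
  rw [sum_mul_fst] at hx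
  simpa [Set.indicator_apply] using hx

theorem ErCost_le {W q : X → Y → ℝ} {Q : X → ℝ} {R : ℝ} {a : ι → X → ℝ} {P P' : X × Y → ℝ}
    (hP : P ∈ setS Y Q a) (hP' : P' ∈ setT q Q a P) :
    ErCost W q Q R a ≤ costObj W Q R P P' :=
  iInf₂_le_of_le P hP (iInf₂_le P' hP')

theorem le_ErCost {W q : X → Y → ℝ} {Q : X → ℝ} {R : ℝ} {a : ι → X → ℝ} {c : EReal}
    (h : ∀ P ∈ setS Y Q a, ∀ P' ∈ setT q Q a P, c ≤ costObj W Q R P P') :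
    c ≤ ErCost W q Q R a :=
  le_iInf₂ fun P hP => le_iInf₂ fun P' hP' => h P hP P' hP'

theorem ErCC_le {W q : X → Y → ℝ} {Q : X → ℝ} {R : ℝ} {P P' : X × Y → ℝ}
    (h : IsCCPair q Q P P') : ErCC W q Q R ≤ costObj W Q R P P' :=
  ErCost_le (mem_setS_indicator_iff.2 ⟨h.1, h.2.2.1⟩)
    ⟨mem_setS_indicator_iff.2 ⟨h.2.1, h.2.2.2.1⟩, h.2.2.2.2⟩

theorem le_ErCC {W q : X → Y → ℝ} {Q : X → ℝ} {R : ℝ} {c : EReal}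
    (h : ∀ P P', IsCCPair q Q P P' → c ≤ costObj W Q R P P') : c ≤ ErCC W q Q R :=
  le_ErCost fun P hP P' hP' => h P P' ⟨hP.1, hP'.1.1, (mem_setS_indicator_iff.1 hP).2,
    (mem_setS_indicator_iff.1 hP'.1).2, hP'.2⟩

theorem exists_of_ErCC_lt {W q : X → Y → ℝ} {Q : X → ℝ} {R : ℝ} {c : EReal}
    (h : ErCC W q Q R < c) : ∃ P P', IsCCPair q Q P P' ∧ costObj W Q R P P' < c := by
  by_contra! hc
  exact h.not_ge (le_ErCC hc)

theorem ErCost_le_ErCC {W q : X → Y → ℝ} {Q : X → ℝ} {R : ℝ} (a : ι → X → ℝ) :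
    ErCost W q Q R a ≤ ErCC W q Q R :=
  le_ErCC fun _ _ h => ErCost_le ⟨h.1, fun _ => sum_mul_cost_eq h.2.2.1 _⟩
    ⟨⟨h.2.1, fun _ => sum_mul_cost_eq h.2.2.2.1 _⟩, h.2.2.2.2⟩

/-- The pairs of distributions with a common `Y`-marginal on which `costObj` is finite and the
second distribution avoids the zeros of the metric. -/
def pairSet (W q : X → Y → ℝ) (Q : X → ℝ) : Set ((X × Y → ℝ) × (X × Y → ℝ)) :=
  {k | k.1 ∈ stdSimplex ℝ (X × Y) ∧ k.2 ∈ stdSimplex ℝ (X × Y) ∧ margY k.2 = margY k.1 ∧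
    (∀ z, joint Q W z = 0 → k.1 z = 0) ∧ (∀ z : X × Y, Q z.1 = 0 → k.2 z = 0) ∧
    ∀ z : X × Y, q z.1 z.2 = 0 → k.2 z = 0}

theorem isClosed_forall_imp_eq_zero {E : Type*} [TopologicalSpace E] {p : Z → Prop}
    {f : E → Z → ℝ} (hf : Continuous f) : IsClosed {k | ∀ z, p z → f k z = 0} := by
  have h : {k | ∀ z, p z → f k z = 0} = ⋂ z, ⋂ _ : p z, {k | f k z = 0} := by
    ext
    simp
  rw [h]
  exact isClosed_iInter fun z => isClosed_iInter fun _ =>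
    isClosed_eq ((continuous_apply z).comp hf) continuous_const

theorem isCompact_pairSet (W q : X → Y → ℝ) (Q : X → ℝ) : IsCompact (pairSet W q Q) := by
  refine ((isCompact_stdSimplex ℝ (X × Y)).prod (isCompact_stdSimplex ℝ (X × Y))).of_isClosed_subset
    ?_ fun k hk => ⟨hk.1, hk.2.1⟩
  refine ((isClosed_stdSimplex ℝ _).preimage continuous_fst).inter
    (((isClosed_stdSimplex ℝ _).preimage continuous_snd).inter (IsClosed.inter ?_
      (IsClosed.inter ?_ (IsClosed.inter ?_ ?_))))
  · exact isClosed_eq (continuous_margY.comp continuous_snd) (continuous_margY.comp continuous_fst)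
  · exact isClosed_forall_imp_eq_zero continuous_fst
  · exact isClosed_forall_imp_eq_zero continuous_snd
  · exact isClosed_forall_imp_eq_zero continuous_snd

theorem convex_pairSet (W q : X → Y → ℝ) (Q : X → ℝ) : Convex ℝ (pairSet W q Q) := by
  rintro k ⟨h1, h2, h3, h4, h5, h6⟩ k' ⟨h1', h2', h3', h4', h5', h6'⟩ s t hs ht hst
  refine ⟨convex_stdSimplex ℝ _ h1 h1' hs ht hst, convex_stdSimplex ℝ _ h2 h2' hs ht hst,
    ?_, fun z hz => ?_, fun z hz => ?_, fun z hz => ?_⟩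
  · simp only [Prod.fst_add, Prod.snd_add, Prod.smul_fst, Prod.smul_snd, margY_add_smul, h3, h3']
  · simp [h4 z hz, h4' z hz]
  · simp [h5 z hz, h5' z hz]
  · simp [h6 z hz, h6' z hz]

section pairSet

variable {W q : X → Y → ℝ} {Q : X → ℝ} {k : (X × Y → ℝ) × (X × Y → ℝ)}

theorem prodDist_imp_of_mem_pairSet (hk : k ∈ pairSet W q Q) (z : X × Y)
    (hz : prodDist Q (margY k.1) z = 0) : k.2 z = 0 := by
  rw [← hk.2.2.1] at hz
  exact prodDist_eq_zero_imp hk.2.1.1 hk.2.2.2.2.1 z hz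

theorem prodDist_add_smul (Q : X → ℝ) (s t : ℝ) (N N' : Y → ℝ) :
    prodDist Q (s • N + t • N') = s • prodDist Q N + t • prodDist Q N' := by
  ext z
  simp only [prodDist, Pi.add_apply, Pi.smul_apply, smul_eq_mul]
  ring

theorem pairSet_klSum_fst_convexOn (hQ : Q ∈ stdSimplex ℝ X) (hW : ∀ x, W x ∈ stdSimplex ℝ Y) :
    ConvexOn ℝ (pairSet W q Q) fun k => klSum k.1 (joint Q W) := by
  refine ⟨convex_pairSet W q Q, fun k hk k' hk' s t hs ht hst => ?_⟩
  have hN := (joint_mem_stdSimplex hQ hW).1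
  have := klSum_add_le hk.1.1 hk'.1.1 hN hN hk.2.2.2.1 hk'.2.2.2.1 hs ht
  rwa [← add_smul, hst, one_smul] at this

theorem pairSet_klSum_snd_convexOn (hQ : Q ∈ stdSimplex ℝ X) (R : ℝ) :
    ConvexOn ℝ (pairSet W q Q) fun k => klSum k.2 (prodDist Q (margY k.1)) - R := by
  refine ⟨convex_pairSet W q Q, fun k hk k' hk' s t hs ht hst => ?_⟩
  have hN : ∀ k ∈ pairSet W q Q, ∀ z, 0 ≤ prodDist Q (margY k.1) z := fun k hk z =>
    mul_nonneg (hQ.1 _) (Finset.sum_nonneg fun x _ => hk.1.1 _)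
  have := klSum_add_le hk.2.1.1 hk'.2.1.1 (hN k hk) (hN k' hk')
    (prodDist_imp_of_mem_pairSet hk) (prodDist_imp_of_mem_pairSet hk') hs ht
  simp only [Prod.fst_add, Prod.snd_add, Prod.smul_fst, Prod.smul_snd, margY_add_smul,
    prodDist_add_smul, smul_eq_mul]
  linear_combination this + R * hst

theorem pairSet_klSum_fst_continuousOn :
    ContinuousOn (fun k => klSum k.1 (joint Q W)) (pairSet W q Q) :=
  ((continuous_klSum_left _).comp continuous_fst).continuousOn

/-- The reference may degenerate as P varies, but P'_Y = P_Y allows the divergence to be written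
with t log t terms of P' alone. -/
theorem pairSet_klSum_snd_continuousOn (R : ℝ) :
    ContinuousOn (fun k => klSum k.2 (prodDist Q (margY k.1)) - R) (pairSet W q Q) := by
  refine ContinuousOn.sub ?_ continuousOn_const
  refine ContinuousOn.congr (f := fun k : (X × Y → ℝ) × (X × Y → ℝ) =>
    klSum k.2 (fun z => Q z.1) - ∑ y, margY k.2 y * Real.log (margY k.2 y)) ?_ fun k hk => ?_
  · refine Continuous.continuousOn (((continuous_klSum_left _).comp continuous_snd).sub
      (continuous_finsetSum _ fun y _ => ?_))
    exact Real.continuous_mul_log.comp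
      ((continuous_apply y).comp (continuous_margY.comp continuous_snd))
  · simp only [← hk.2.2.1]
    exact klSum_prodDist_margY hk.2.1.1 hk.2.2.2.2.1

theorem costObj_eq_coe_of_mem_pairSet (R : ℝ) (hk : k ∈ pairSet W q Q) :
    costObj W Q R k.1 k.2 = (costObjReal W Q R k.1 k.2 : EReal) :=
  costObj_eq_coe R hk.2.2.2.1 (prodDist_imp_of_mem_pairSet hk)

end pairSet

/-- The difference `E_{P'}[log q] - E_P[log q]` as a linear functional of the pair `(P, P')`. -/
def logGap (q : X → Y → ℝ) : ((X × Y → ℝ) × (X × Y → ℝ)) →L[ℝ] ℝ :=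
  ∑ z : X × Y, Real.log (q z.1 z.2) •
    ((ContinuousLinearMap.proj z).comp (ContinuousLinearMap.snd ℝ _ _)
      - (ContinuousLinearMap.proj z).comp (ContinuousLinearMap.fst ℝ _ _))

theorem logGap_apply (q : X → Y → ℝ) (k : (X × Y → ℝ) × (X × Y → ℝ)) :
    logGap q k = ∑ z, k.2 z * Real.log (q z.1 z.2) - ∑ z, k.1 z * Real.log (q z.1 z.2) := by
  simp only [logGap, sum_apply, smul_apply,
    sub_apply, ContinuousLinearMap.comp_apply, ContinuousLinearMap.proj_apply,
    ContinuousLinearMap.coe_fst', ContinuousLinearMap.coe_snd', smul_eq_mul,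
    ← Finset.sum_sub_distrib]
  exact Finset.sum_congr rfl fun z _ => by ring

/-- The `X`-marginal as a continuous linear map. -/
def margXL (X Y : Type*) [Fintype X] [Fintype Y] : (X × Y → ℝ) →L[ℝ] (X → ℝ) :=
  ContinuousLinearMap.pi fun x => ∑ y, ContinuousLinearMap.proj (x, y)

@[simp]
theorem margXL_apply (P : X × Y → ℝ) : margXL X Y P = margX P := by
  ext x
  simp [margXL, margX]

/-- On `pairSet` neither expectation is −∞ once q vanishes only off the support of Q × W, so the
metric constraint becomes a linear inequality. -/
theorem expLog_le_iff_logGap {W q : X → Y → ℝ} {Q : X → ℝ}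
    (hq : ∀ z : X × Y, q z.1 z.2 = 0 → joint Q W z = 0)
    {k : (X × Y → ℝ) × (X × Y → ℝ)} (hk : k ∈ pairSet W q Q) :
    expLog k.1 (fun z => q z.1 z.2) ≤ expLog k.2 (fun z => q z.1 z.2) ↔ 0 ≤ logGap q k := by
  rw [expLog_eq_coe fun z hz => hk.2.2.2.1 z (hq z hz), expLog_eq_coe hk.2.2.2.2.2,
    EReal.coe_le_coe_iff, logGap_apply, sub_nonneg]

/-- A pair admissible for the cost-constrained exponent either has infinite objective or lies in
`pairSet`. -/
theorem mem_pairSet_of_costObj_ne_top {W q : X → Y → ℝ} {Q : X → ℝ} {R : ℝ}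
    (hq : ∀ z : X × Y, q z.1 z.2 = 0 → joint Q W z = 0) {P P' : X × Y → ℝ}
    (hP : P ∈ stdSimplex ℝ (X × Y)) (hP' : P' ∈ stdSimplex ℝ (X × Y))
    (hY : margY P' = margY P)
    (hle : expLog P (fun z => q z.1 z.2) ≤ expLog P' (fun z => q z.1 z.2))
    (h : costObj W Q R P P' ≠ ⊤) : (P, P') ∈ pairSet W q Q ∧ 0 ≤ logGap q (P, P') := by
  obtain ⟨h1, h2⟩ := not_not.mp (mt (costObj_eq_top R) h)
  have hk : (P, P') ∈ pairSet W q Q := by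
    refine ⟨hP, hP', hY, h1, fun z hz => h2 z (by simp [prodDist, hz]), fun z hz => ?_⟩
    by_contra hne
    rw [expLog_eq_bot (P := P') ⟨z, hne, hz⟩,
      expLog_eq_coe fun z hz => h1 z (hq z hz)] at hle
    exact absurd (le_bot_iff.mp hle) (EReal.coe_ne_bot _)
  exact ⟨hk, (expLog_le_iff_logGap hq hk).mp hle⟩

end

end MismatchedDecoding

/-! ### Multipliers as costs: two for any metric, one for maximum likelihood -/

namespace MismatchedDecoding

set_option linter.unusedSectionVars false

noncomputable section

variable {X Y Z ι : Type*} [Fintype X] [Fintype Y] [Fintype Z]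

theorem relEntropy_nonneg {P N : Z → ℝ} (hP : P ∈ stdSimplex ℝ Z) (hN : N ∈ stdSimplex ℝ Z) :
    0 ≤ relEntropy P N := by
  by_cases h : ∀ z, N z = 0 → P z = 0
  · rw [relEntropy_eq_klSum h]
    exact_mod_cast klSum_nonneg hP hN h
  · rw [relEntropy_eq_top h]
    exact le_top

theorem prodDist_mem_stdSimplex {Q : X → ℝ} {N : Y → ℝ} (hQ : Q ∈ stdSimplex ℝ X)
    (hN : N ∈ stdSimplex ℝ Y) : prodDist Q N ∈ stdSimplex ℝ (X × Y) :=
  joint_mem_stdSimplex hQ fun _ => hN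

/-- This meets the bound of `ErCC_le_of_metric_eq_zero`, so zero costs suffice in that degenerate
case. -/
theorem max_zero_neg_le_costObj {W : X → Y → ℝ} (hW : ∀ x, W x ∈ stdSimplex ℝ Y) {Q : X → ℝ}
    (hQ : Q ∈ stdSimplex ℝ X) (R : ℝ) {P P' : X × Y → ℝ} (hP : P ∈ stdSimplex ℝ (X × Y))
    (hP' : P' ∈ stdSimplex ℝ (X × Y)) : ((max 0 (-R) : ℝ) : EReal) ≤ costObj W Q R P P' := by
  have h1 := relEntropy_nonneg hP (joint_mem_stdSimplex hQ hW)
  have h2 := relEntropy_nonneg hP' (prodDist_mem_stdSimplex hQ (margY_mem_stdSimplex hP))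
  have h3 : ((-R : ℝ) : EReal) ≤ relEntropy P' (prodDist Q (margY P)) - (R : EReal) := by
    have := EReal.sub_le_sub h2 (le_refl (R : EReal))
    rwa [zero_sub] at this
  calc ((max 0 (-R) : ℝ) : EReal) = 0 + max 0 ((-R : ℝ) : EReal) := by
        rw [zero_add]; norm_cast
    _ ≤ _ := add_le_add h1 (max_le_max le_rfl h3)

/-- If the metric vanishes at a transition of positive probability, then the constant-composition
exponent is trivial. -/
theorem ErCC_le_of_metric_eq_zero {W q : X → Y → ℝ} (hW : ∀ x, W x ∈ stdSimplex ℝ Y) {Q : X → ℝ}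
    (hQ : Q ∈ stdSimplex ℝ X) (R : ℝ)
    (hq : ¬ ∀ z : X × Y, q z.1 z.2 = 0 → joint Q W z = 0) :
    ErCC W q Q R ≤ ((max 0 (-R) : ℝ) : EReal) := by
  push Not at hq
  obtain ⟨z, hz, hz'⟩ := hq
  have hJ := joint_mem_stdSimplex hQ hW
  have hN := margY_mem_stdSimplex hJ
  -- For P = Q × W the expected log-metric is −∞, so the independent P' is admissible, and both
  -- divergences are zero.
  have hpair : IsCCPair q Q (joint Q W) (prodDist Q (margY (joint Q W))) := by
    refine ⟨hJ, prodDist_mem_stdSimplex hQ hN, margX_joint hW, margX_joint fun _ => hN, ?_, ?_⟩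
    · ext y
      simp only [margY, prodDist, ← Finset.sum_mul, hQ.2, one_mul]
    · rw [expLog_eq_bot ⟨z, hz', hz⟩]
      exact bot_le
  refine (ErCC_le hpair).trans ?_
  rw [costObj_eq_coe R (fun _ h => h) (fun _ h => h), costObjReal]
  simp

theorem mul_le_max_zero {ρ x : ℝ} (h0 : 0 ≤ ρ) (h1 : ρ ≤ 1) : ρ * x ≤ max 0 x := by
  rcases le_total 0 x with h | h
  · rw [max_eq_right h]
    exact mul_le_of_le_one_left h h1
  · rw [max_eq_left h]
    exact mul_nonpos_of_nonneg_of_nonpos h0 h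

theorem sum_mul_margX_sub {P : X × Y → ℝ} {Q a : X → ℝ}
    (h : ∑ z, P z * a z.1 = ∑ x, Q x * a x) : ∑ x, a x * (margX P x - Q x) = 0 := by
  rw [sum_mul_fst] at h
  rw [← sub_eq_zero, ← Finset.sum_sub_distrib] at h
  rw [← h]
  exact Finset.sum_congr rfl fun x _ => by ring

/-- The Lagrangian bound holds for all pairs, not only those of composition Q; with the multipliers
as costs, the cost constraints cancel the linear terms and leave the objective. -/
theorem exists_costs_le_ErCost {W q : X → Y → ℝ} (hW : ∀ x, W x ∈ stdSimplex ℝ Y) {Q : X → ℝ}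
    (hQ : Q ∈ stdSimplex ℝ X) {R : ℝ} (hq : ∀ z : X × Y, q z.1 z.2 = 0 → joint Q W z = 0)
    {c : ℝ} (hc : (c : EReal) < ErCC W q Q R) :
    ∃ a₁ a₂ : X → ℝ, (c : EReal) ≤ ErCost W q Q R ![a₁, a₂] := by
  let G : ((X × Y → ℝ) × (X × Y → ℝ)) →L[ℝ] (X ⊕ X → ℝ) :=
    ContinuousLinearMap.pi (Sum.elim
      (fun x => (ContinuousLinearMap.proj x).comp
        ((margXL X Y).comp (ContinuousLinearMap.fst ℝ _ _)))
      (fun x => (ContinuousLinearMap.proj x).comp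
        ((margXL X Y).comp (ContinuousLinearMap.snd ℝ _ _))))
  have hG₁ : ∀ k x, G k (Sum.inl x) = margX k.1 x := fun k x => by simp [G]
  have hG₂ : ∀ k x, G k (Sum.inr x) = margX k.2 x := fun k x => by simp [G]
  obtain ⟨ρ, s, l, hρ, hρ1, hs, hl⟩ := exists_lagrange_multipliers (isCompact_pairSet W q Q)
    (convex_pairSet W q Q) pairSet_klSum_fst_continuousOn (pairSet_klSum_snd_continuousOn R)
    (pairSet_klSum_fst_convexOn hQ hW) (pairSet_klSum_snd_convexOn hQ R) (logGap q) G
    (Sum.elim Q Q) (c := c) (by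
      intro k hk hgap hGk
      have e1 : margX k.1 = Q := by
        ext x
        rw [← hG₁, hGk, Sum.elim_inl]
      have e2 : margX k.2 = Q := by
        ext x
        rw [← hG₂, hGk, Sum.elim_inr]
      have := hc.trans_le (ErCC_le (R := R) (W := W)
        ⟨hk.1, hk.2.1, e1, e2, hk.2.2.1, (expLog_le_iff_logGap hq hk).2 hgap⟩)
      rw [costObj_eq_coe_of_mem_pairSet R hk] at this
      exact_mod_cast this)
  refine ⟨fun x => l (Sum.inl x), fun x => l (Sum.inr x), le_ErCost fun P hP P' hP' => ?_⟩
  by_cases htop : costObj W Q R P P' = ⊤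
  · rw [htop]; exact le_top
  obtain ⟨hk, hgap⟩ := mem_pairSet_of_costObj_ne_top hq hP.1 hP'.1.1 hP'.2.1 hP'.2.2 htop
  have h := hl _ hk
  have e1 := sum_mul_margX_sub (hP.2 0)
  have e2 := sum_mul_margX_sub (hP'.1.2 1)
  rw [costObj_eq_coe_of_mem_pairSet R hk, EReal.coe_le_coe_iff, costObjReal]
  simp only [Fintype.sum_sum_type, hG₁, hG₂, Sum.elim_inl, Sum.elim_inr] at h
  simp only [Matrix.cons_val_zero, Matrix.cons_val_one] at e1 e2
  rw [e1, e2] at h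
  have h3 := mul_le_max_zero (x := klSum P' (prodDist Q (margY P)) - R) hρ.le hρ1
  have h4 := mul_nonneg hs.le hgap
  linarith

/-- Two costs suffice to attain the constant-composition exponent. -/
theorem iSup_ErCost_two_eq_ErCC {W q : X → Y → ℝ} (hW : ∀ x, W x ∈ stdSimplex ℝ Y) {Q : X → ℝ}
    (hQ : Q ∈ stdSimplex ℝ X) (R : ℝ) :
    (⨆ (a₁ : X → ℝ) (a₂ : X → ℝ), ErCost W q Q R ![a₁, a₂]) = ErCC W q Q R := by
  refine le_antisymm (iSup₂_le fun _ _ => ErCost_le_ErCC _) ?_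
  by_cases hq : ∀ z : X × Y, q z.1 z.2 = 0 → joint Q W z = 0
  · refine EReal.ge_of_forall_gt_iff_ge.1 fun c hc => ?_
    obtain ⟨a₁, a₂, h⟩ := exists_costs_le_ErCost hW hQ hq hc
    exact le_iSup₂_of_le a₁ a₂ h
  · refine (ErCC_le_of_metric_eq_zero hW hQ R hq).trans (le_iSup₂_of_le 0 0 ?_)
    exact le_ErCost fun P hP P' hP' => max_zero_neg_le_costObj hW hQ R hP.1 hP'.1.1

theorem klSum_joint_eq_sub {P : X × Y → ℝ} {Q : X → ℝ} {W : X → Y → ℝ}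
    (h : ∀ z, joint Q W z = 0 → P z = 0) :
    klSum P (joint Q W) = klSum P (fun z => Q z.1) - ∑ z, P z * Real.log (W z.1 z.2) := by
  rw [klSum, klSum, ← Finset.sum_sub_distrib]
  refine Finset.sum_congr rfl fun z _ => ?_
  by_cases hz : P z = 0
  · simp [hz]
  have hj : Q z.1 * W z.1 z.2 ≠ 0 := fun h0 => hz (h z h0)
  rw [← mul_sub, joint, ← div_div,
    Real.log_div (div_ne_zero hz (left_ne_zero_of_mul hj)) (right_ne_zero_of_mul hj)]

theorem diag_mem_pairSet_iff {W : X → Y → ℝ} {Q : X → ℝ} {P : X × Y → ℝ} :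
    (P, P) ∈ pairSet W W Q ↔
      P ∈ stdSimplex ℝ (X × Y) ∧ ∀ z, joint Q W z = 0 → P z = 0 :=
  ⟨fun h => ⟨h.1, h.2.2.2.1⟩, fun h => ⟨h.1, h.1, rfl, h.2,
    fun z hz => h.2 z (by simp [joint, hz]), fun z hz => h.2 z (by simp [joint, hz])⟩⟩

theorem joint_eq_zero_of_channel_eq_zero (W : X → Y → ℝ) (Q : X → ℝ) (z : X × Y)
    (hz : W z.1 z.2 = 0) : joint Q W z = 0 := by
  simp [joint, hz]

/-- With the maximum-likelihood metric, the Lagrangian with `s = ρ / (1 + ρ)` at `(P, P')` is a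
convex combination of its values at `(P, P)` and `(P', P')`. -/
theorem klSum_add_sub_logGap_eq {W : X → Y → ℝ} {Q : X → ℝ} {P P' : X × Y → ℝ}
    (hk : (P, P') ∈ pairSet W W Q) {ρ : ℝ} (hρ : 0 ≤ ρ) :
    klSum P (joint Q W) + ρ * klSum P' (prodDist Q (margY P)) - ρ / (1 + ρ) * logGap W (P, P')
      = (1 / (1 + ρ)) * (klSum P (joint Q W) + ρ * klSum P (prodDist Q (margY P)))
        + (ρ / (1 + ρ)) * (klSum P' (joint Q W) + ρ * klSum P' (prodDist Q (margY P'))) := by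
  obtain ⟨hP, hP', hY, h1, h2, h3⟩ := hk
  have h1' : ∀ z : X × Y, Q z.1 = 0 → P z = 0 := fun z hz => h1 z (by simp [joint, hz])
  have h4 : ∀ z, joint Q W z = 0 → P' z = 0 := fun z hz => by
    rcases mul_eq_zero.mp hz with h | h
    exacts [h2 z h, h3 z h]
  have e1 := klSum_prodDist_margY hP.1 h1'
  have e2 := klSum_prodDist_margY hP'.1 h2
  have e3 : margY P' = margY P := hY
  rw [e3] at e2 ⊢
  rw [e1, e2, klSum_joint_eq_sub h1, klSum_joint_eq_sub h4, logGap_apply]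
  have : 1 + ρ ≠ 0 := by positivity
  field_simp
  ring

/-- Duality is applied only to diagonal pairs, giving one multiplier; averaging the bounds at (P, P)
and (P', P') with weights 1/(1+ρ) and ρ/(1+ρ) then controls an arbitrary pair. -/
theorem exists_cost_le_ErCost {W : X → Y → ℝ} (hW : ∀ x, W x ∈ stdSimplex ℝ Y) {Q : X → ℝ}
    (hQ : Q ∈ stdSimplex ℝ X) {R : ℝ} {c : ℝ} (hc : (c : EReal) < ErCC W W Q R) :
    ∃ a : X → ℝ, (c : EReal) ≤ ErCost W W Q R ![a] := by
  have hq := joint_eq_zero_of_channel_eq_zero W Q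
  let diag : (X × Y → ℝ) →ₗ[ℝ] (X × Y → ℝ) × (X × Y → ℝ) := LinearMap.id.prod LinearMap.id
  have hd : ∀ P, diag P = (P, P) := fun _ => rfl
  have hdiag : Continuous diag := continuous_id.prodMk continuous_id
  have hK : IsCompact (diag ⁻¹' pairSet W W Q) :=
    (isCompact_stdSimplex ℝ (X × Y)).of_isClosed_subset
      ((isCompact_pairSet W W Q).isClosed.preimage hdiag) fun P hP => hP.1
  -- The metric constraint is an equality on the diagonal, so the inequality functional is 0 and the
  -- resulting s is irrelevant; ρ/(1+ρ) takes its place below.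
  obtain ⟨ρ, s, l, hρ, hρ1, hs, hl⟩ := exists_lagrange_multipliers hK
    ((convex_pairSet W W Q).linear_preimage diag)
    (pairSet_klSum_fst_continuousOn.comp hdiag.continuousOn fun _ h => h)
    ((pairSet_klSum_snd_continuousOn R).comp hdiag.continuousOn fun _ h => h)
    ((pairSet_klSum_fst_convexOn hQ hW).comp_linearMap diag)
    ((pairSet_klSum_snd_convexOn hQ R).comp_linearMap diag) 0 (margXL X Y) Q (c := c) (by
      intro P hP _ hGk
      rw [margXL_apply] at hGk
      have hP' : (P, P) ∈ pairSet W W Q := hP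
      have := hc.trans_le (ErCC_le (R := R) (W := W)
        ⟨hP'.1, hP'.1, hGk, hGk, rfl, le_rfl⟩)
      rw [costObj_eq_coe_of_mem_pairSet R hP'] at this
      exact_mod_cast this)
  refine ⟨l, le_ErCost fun P hP P' hP' => ?_⟩
  by_cases htop : costObj W Q R P P' = ⊤
  · rw [htop]; exact le_top
  obtain ⟨hk, hgap⟩ := mem_pairSet_of_costObj_ne_top hq hP.1 hP'.1.1 hP'.2.1 hP'.2.2 htop
  have hP1 : (P, P) ∈ pairSet W W Q := diag_mem_pairSet_iff.2 ⟨hk.1, hk.2.2.2.1⟩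
  have hP2 : (P', P') ∈ pairSet W W Q := diag_mem_pairSet_iff.2 ⟨hk.2.1, fun z hz => by
    rcases mul_eq_zero.mp hz with h | h
    exacts [hk.2.2.2.2.1 z h, hk.2.2.2.2.2 z h]⟩
  have h1 := hl P hP1
  have h2 := hl P' hP2
  have e1 := sum_mul_margX_sub (hP.2 0)
  have e2 := sum_mul_margX_sub (hP'.1.2 0)
  simp only [Matrix.cons_val_zero] at e1 e2
  simp only [margXL_apply, e1, e2, Function.comp_apply, hd, zero_apply, mul_zero, sub_zero, add_zero] at h1 h2
  have h3 := mul_le_max_zero (x := klSum P' (prodDist Q (margY P)) - R) hρ.le hρ1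
  have h4 := klSum_add_sub_logGap_eq hk hρ.le
  have h5 : 0 ≤ ρ / (1 + ρ) * logGap W (P, P') := mul_nonneg (by positivity) hgap
  have h6 : c + ρ * R ≤
      (1 / (1 + ρ)) * (klSum P (joint Q W) + ρ * klSum P (prodDist Q (margY P)))
        + (ρ / (1 + ρ)) * (klSum P' (joint Q W) + ρ * klSum P' (prodDist Q (margY P'))) := by
    have w1 : 0 ≤ 1 / (1 + ρ) := by positivity
    have w2 : 0 ≤ ρ / (1 + ρ) := by positivity
    have w3 : 1 / (1 + ρ) + ρ / (1 + ρ) = 1 := by field_simp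
    calc c + ρ * R = (1 / (1 + ρ)) * (c + ρ * R) + (ρ / (1 + ρ)) * (c + ρ * R) := by
          rw [← add_mul, w3, one_mul]
      _ ≤ _ := add_le_add (mul_le_mul_of_nonneg_left (by linarith) w1)
          (mul_le_mul_of_nonneg_left (by linarith) w2)
  rw [costObj_eq_coe_of_mem_pairSet R hk, EReal.coe_le_coe_iff, costObjReal]
  simp only at *
  linarith

/-- With maximum-likelihood decoding, one cost suffices to attain the constant-composition
exponent. -/
theorem iSup_ErCost_one_eq_ErCC {W : X → Y → ℝ} (hW : ∀ x, W x ∈ stdSimplex ℝ Y) {Q : X → ℝ}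
    (hQ : Q ∈ stdSimplex ℝ X) (R : ℝ) :
    (⨆ a₁ : X → ℝ, ErCost W W Q R ![a₁]) = ErCC W W Q R := by
  refine le_antisymm (iSup_le fun _ => ErCost_le_ErCC _) ?_
  refine EReal.ge_of_forall_gt_iff_ge.1 fun c hc => ?_
  obtain ⟨a, h⟩ := exists_cost_le_ErCost hW hQ hc
  exact le_iSup_of_le a h

end

end MismatchedDecoding

/-! ### Tilted distributions and weak duality -/

namespace MismatchedDecoding

set_option linter.unusedSectionVars false

noncomputable section

variable {X Y : Type*} [Fintype X] [Fintype Y]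

/-- The tilted metric `q(x,y)^s e^{a(x)}`. -/
def tiltedMetric (q : X → Y → ℝ) (s : ℝ) (a : X → ℝ) (x : X) (y : Y) : ℝ :=
  q x y ^ s * Real.exp (a x)

/-- The average `E[v(X̄, y)]` of a metric `v` with `X̄ ∼ Q`. -/
def avgMetric (Q : X → ℝ) (v : X → Y → ℝ) (y : Y) : ℝ := ∑ x, Q x * v x y

/-- `E[(E[v(X̄,Y) | Y] / v(X,Y))^ρ]` with `(X, Y) ∼ Q × W`. -/
def tiltedSum (W : X → Y → ℝ) (Q : X → ℝ) (v : X → Y → ℝ) (ρ : ℝ) : ℝ :=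
  ∑ z : X × Y, joint Q W z * (avgMetric Q v z.2 / v z.1 z.2) ^ ρ

theorem tiltedMetric_nonneg {q : X → Y → ℝ} (hq : ∀ x y, 0 ≤ q x y) (s : ℝ) (a : X → ℝ) (x : X)
    (y : Y) : 0 ≤ tiltedMetric q s a x y :=
  mul_nonneg (Real.rpow_nonneg (hq x y) s) (Real.exp_pos _).le

theorem tiltedMetric_eq_zero_iff {q : X → Y → ℝ} {s : ℝ} {a : X → ℝ} {x : X} {y : Y} :
    tiltedMetric q s a x y = 0 ↔ q x y ^ s = 0 := by
  simp [tiltedMetric, Real.exp_ne_zero]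

theorem log_tiltedMetric {q : X → Y → ℝ} (hq : ∀ x y, 0 ≤ q x y) {s : ℝ} {a : X → ℝ} {x : X}
    {y : Y} (h : tiltedMetric q s a x y ≠ 0) :
    Real.log (tiltedMetric q s a x y) = s * Real.log (q x y) + a x := by
  have h' : q x y ^ s ≠ 0 := fun h0 => h (tiltedMetric_eq_zero_iff.2 h0)
  rw [tiltedMetric, Real.log_mul h' (Real.exp_ne_zero _), Real.log_exp]
  -- A zero of the metric has nonzero power only for s = 0, where 0^0 = 1.
  rcases (hq x y).eq_or_lt with h0 | h0
  · rw [← h0] at h' ⊢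
    have : s = 0 := by
      by_contra hs
      exact h' (Real.zero_rpow hs)
    simp [this]
  · rw [Real.log_rpow h0]

section Gibbs

variable {W : X → Y → ℝ} {Q : X → ℝ} {v : X → Y → ℝ}

theorem avgMetric_nonneg (hQ : ∀ x, 0 ≤ Q x) (hv : ∀ x y, 0 ≤ v x y) (y : Y) :
    0 ≤ avgMetric Q v y :=
  Finset.sum_nonneg fun x _ => mul_nonneg (hQ x) (hv x y)

theorem avgMetric_pos (hQ : ∀ x, 0 ≤ Q x) (hv : ∀ x y, 0 ≤ v x y) {x : X} {y : Y} (hx : Q x ≠ 0)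
    (hxy : v x y ≠ 0) : 0 < avgMetric Q v y :=
  Finset.sum_pos' (fun x _ => mul_nonneg (hQ x) (hv x y))
    ⟨x, Finset.mem_univ _, mul_pos ((hQ x).lt_of_ne' hx) ((hv x y).lt_of_ne' hxy)⟩

theorem avgMetric_pos_of_joint_ne_zero (hQ : ∀ x, 0 ≤ Q x) (hv : ∀ x y, 0 ≤ v x y)
    (hvJ : ∀ z : X × Y, v z.1 z.2 = 0 → joint Q W z = 0) {z : X × Y} (hz : joint Q W z ≠ 0) :
    0 < avgMetric Q v z.2 :=
  avgMetric_pos hQ hv (left_ne_zero_of_mul hz) (mt (hvJ z) hz)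

theorem tiltedSum_term_nonneg (hQ : ∀ x, 0 ≤ Q x) (hW : ∀ x y, 0 ≤ W x y)
    (hv : ∀ x y, 0 ≤ v x y) (ρ : ℝ) (z : X × Y) :
    0 ≤ joint Q W z * (avgMetric Q v z.2 / v z.1 z.2) ^ ρ :=
  mul_nonneg (mul_nonneg (hQ _) (hW _ _))
    (Real.rpow_nonneg (div_nonneg (avgMetric_nonneg hQ hv _) (hv _ _)) _)

theorem tiltedSum_term_pos (hQ : ∀ x, 0 ≤ Q x) (hW : ∀ x y, 0 ≤ W x y)
    (hv : ∀ x y, 0 ≤ v x y) (hvJ : ∀ z : X × Y, v z.1 z.2 = 0 → joint Q W z = 0) (ρ : ℝ)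
    {z : X × Y} (hz : joint Q W z ≠ 0) :
    0 < joint Q W z * (avgMetric Q v z.2 / v z.1 z.2) ^ ρ :=
  mul_pos (lt_of_le_of_ne' (mul_nonneg (hQ _) (hW _ _)) hz)
    (Real.rpow_pos_of_pos (div_pos (avgMetric_pos_of_joint_ne_zero hQ hv hvJ hz)
      ((hv _ _).lt_of_ne' (mt (hvJ z) hz))) _)

theorem tiltedSum_pos (hQ : Q ∈ stdSimplex ℝ X) (hW : ∀ x, W x ∈ stdSimplex ℝ Y)
    (hv : ∀ x y, 0 ≤ v x y) (hvJ : ∀ z : X × Y, v z.1 z.2 = 0 → joint Q W z = 0) (ρ : ℝ) :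
    0 < tiltedSum W Q v ρ := by
  obtain ⟨z, hz⟩ : ∃ z, joint Q W z ≠ 0 := by
    by_contra! h
    have := (joint_mem_stdSimplex hQ hW).2
    simp [h] at this
  exact Finset.sum_pos' (fun z _ => tiltedSum_term_nonneg hQ.1 (fun x => (hW x).1) hv ρ z)
    ⟨z, Finset.mem_univ _, tiltedSum_term_pos hQ.1 (fun x => (hW x).1) hv hvJ ρ hz⟩

theorem log_avgMetric_div_rpow (hQ : ∀ x, 0 ≤ Q x) (hv : ∀ x y, 0 ≤ v x y)
    (hvJ : ∀ z : X × Y, v z.1 z.2 = 0 → joint Q W z = 0) (ρ : ℝ) {z : X × Y}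
    (hz : joint Q W z ≠ 0) :
    Real.log ((avgMetric Q v z.2 / v z.1 z.2) ^ ρ)
      = ρ * (Real.log (avgMetric Q v z.2) - Real.log (v z.1 z.2)) := by
  have hA := avgMetric_pos_of_joint_ne_zero hQ hv hvJ hz
  have hv0 : 0 < v z.1 z.2 := (hv _ _).lt_of_ne' (mt (hvJ z) hz)
  rw [Real.log_rpow (div_pos hA hv0), Real.log_div hA.ne' hv0.ne']

theorem sum_mul_log_avgMetric_eq {P P' : X × Y → ℝ} (h : margY P' = margY P) (f : Y → ℝ) :
    ∑ z, P' z * f z.2 = ∑ z, P z * f z.2 := by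
  rw [sum_mul_snd, sum_mul_snd, h]

/-- The exponent functional is a lower bound for the Lagrangian of the cost-constrained
problem. -/
theorem neg_log_tiltedSum_le (hQ : Q ∈ stdSimplex ℝ X) (hW : ∀ x, W x ∈ stdSimplex ℝ Y)
    (hv : ∀ x y, 0 ≤ v x y) (hvJ : ∀ z : X × Y, v z.1 z.2 = 0 → joint Q W z = 0)
    {ρ : ℝ} (hρ : 0 ≤ ρ) {P P' : X × Y → ℝ} (hP : P ∈ stdSimplex ℝ (X × Y))
    (hP' : P' ∈ stdSimplex ℝ (X × Y)) (hY : margY P' = margY P)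
    (hPJ : ∀ z, joint Q W z = 0 → P z = 0) (hPQ : ∀ z : X × Y, Q z.1 = 0 → P' z = 0)
    (hPv : ∀ z : X × Y, v z.1 z.2 = 0 → P' z = 0)
    (hlog : ∑ z, P z * Real.log (v z.1 z.2) ≤ ∑ z, P' z * Real.log (v z.1 z.2)) :
    -Real.log (tiltedSum W Q v ρ)
      ≤ klSum P (joint Q W) + ρ * klSum P' (prodDist Q (margY P)) := by
  have hW' : ∀ x y, 0 ≤ W x y := fun x => (hW x).1
  have hAP : ∀ z : X × Y, P z ≠ 0 → 0 < avgMetric Q v z.2 := fun z hz =>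
    avgMetric_pos_of_joint_ne_zero hQ.1 hv hvJ (mt (hPJ z) hz)
  have hAY : ∀ y, avgMetric Q v y = 0 → margY P y = 0 := fun y hy =>
    Finset.sum_eq_zero fun x _ => by
      by_contra h
      exact (hAP (x, y) h).ne' hy
  -- The Gibbs bound for P against unnormalized weights of total mass `tiltedSum`.
  have h1 := neg_log_sum_le_klSum hP (tiltedSum_term_nonneg hQ.1 hW' hv ρ) fun z hz => by
    by_contra h
    exact (tiltedSum_term_pos hQ.1 hW' hv hvJ ρ (mt (hPJ z) h)).ne' hz
  have e1 : klSum P (fun z => joint Q W z * (avgMetric Q v z.2 / v z.1 z.2) ^ ρ)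
      = klSum P (joint Q W) - ρ * (∑ z, P z * Real.log (avgMetric Q v z.2)
        - ∑ z, P z * Real.log (v z.1 z.2)) := by
    rw [klSum, klSum, ← Finset.sum_sub_distrib, Finset.mul_sum, ← Finset.sum_sub_distrib]
    refine Finset.sum_congr rfl fun z _ => ?_
    by_cases hz : P z = 0
    · simp [hz]
    have hJ := mt (hPJ z) hz
    have hpos := tiltedSum_term_pos hQ.1 hW' hv hvJ ρ hJ
    rw [← div_div, Real.log_div (div_ne_zero hz hJ) (right_ne_zero_of_mul hpos.ne'),
      log_avgMetric_div_rpow hQ.1 hv hvJ ρ hJ]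
    ring
  -- P_Y combined with the posterior Q·v/E_Q[v] of X̄ given y. It has mass 1, so D(P'‖M) ≥ 0 bounds
  -- D(P'‖Q × P_Y) from below.
  let M : X × Y → ℝ := fun z => prodDist Q (margY P) z * (v z.1 z.2 / avgMetric Q v z.2)
  have hNY := margY_mem_stdSimplex hP
  have hM0 : ∀ z, 0 ≤ M z := fun z => mul_nonneg (mul_nonneg (hQ.1 _) (hNY.1 _))
    (div_nonneg (hv _ _) (avgMetric_nonneg hQ.1 hv _))
  have hMac : ∀ z, M z = 0 → P' z = 0 := fun z hz => by
    rcases mul_eq_zero.mp hz with h | h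
    · rcases mul_eq_zero.mp h with h | h
      · exact hPQ z h
      · exact eq_zero_of_margY_eq_zero hP'.1 (hY ▸ h)
    · rcases div_eq_zero_iff.mp h with h | h
      · exact hPv z h
      · exact eq_zero_of_margY_eq_zero hP'.1 (hY ▸ hAY _ h)
  have hMsum : ∑ z, M z = 1 := by
    rw [← hNY.2, Fintype.sum_prod_type_right]
    refine Finset.sum_congr rfl fun y _ => ?_
    by_cases hy : avgMetric Q v y = 0
    · simp [M, hy, hAY y hy]
    · calc ∑ x, M (x, y) = margY P y / avgMetric Q v y * avgMetric Q v y := by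
            rw [avgMetric, Finset.mul_sum]
            refine Finset.sum_congr rfl fun x _ => ?_
            simp only [M, prodDist, avgMetric]
            ring
        _ = margY P y := div_mul_cancel₀ _ hy
  have h2 := sum_sub_sum_le_klSum hP'.1 hM0 hMac
  rw [hMsum, hP'.2, sub_self] at h2
  have e2 : klSum P' M = klSum P' (prodDist Q (margY P))
      - (∑ z, P' z * Real.log (v z.1 z.2) - ∑ z, P' z * Real.log (avgMetric Q v z.2)) := by
    rw [klSum, klSum, ← Finset.sum_sub_distrib, ← Finset.sum_sub_distrib]
    refine Finset.sum_congr rfl fun z _ => ?_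
    by_cases hz : P' z = 0
    · simp [hz]
    have hM := mt (hMac z) hz
    have hp := left_ne_zero_of_mul hM
    have hr := right_ne_zero_of_mul hM
    have hv0 : v z.1 z.2 ≠ 0 := fun h => hr (by simp [h])
    have hA0 : avgMetric Q v z.2 ≠ 0 := fun h => hr (by simp [h])
    simp only [M]
    rw [← div_div, Real.log_div (div_ne_zero hz hp) hr, Real.log_div hv0 hA0]
    ring
  rw [e2, sum_mul_log_avgMetric_eq hY fun y => Real.log (avgMetric Q v y)] at h2
  rw [e1] at h1
  have h3 : 0 ≤ ρ * (klSum P' (prodDist Q (margY P))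
      - (∑ z, P z * Real.log (v z.1 z.2) - ∑ z, P z * Real.log (avgMetric Q v z.2))) :=
    mul_nonneg hρ (by linarith)
  simp only [tiltedSum]
  linarith

/-- The first component of the minimizer of the Lagrangian. -/
def tiltedDist (W : X → Y → ℝ) (Q : X → ℝ) (v : X → Y → ℝ) (ρ : ℝ) (z : X × Y) : ℝ :=
  joint Q W z * (avgMetric Q v z.2 / v z.1 z.2) ^ ρ / tiltedSum W Q v ρ

/-- The second component of the minimizer of the Lagrangian. -/
def tiltedDist' (W : X → Y → ℝ) (Q : X → ℝ) (v : X → Y → ℝ) (ρ : ℝ) (z : X × Y) : ℝ :=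
  prodDist Q (margY (tiltedDist W Q v ρ)) z * (v z.1 z.2 / avgMetric Q v z.2)

theorem tiltedDist_mem_stdSimplex (hQ : Q ∈ stdSimplex ℝ X) (hW : ∀ x, W x ∈ stdSimplex ℝ Y)
    (hv : ∀ x y, 0 ≤ v x y) (hvJ : ∀ z : X × Y, v z.1 z.2 = 0 → joint Q W z = 0) (ρ : ℝ) :
    tiltedDist W Q v ρ ∈ stdSimplex ℝ (X × Y) := by
  have hpos := tiltedSum_pos hQ hW hv hvJ ρ
  refine ⟨fun z => div_nonneg (tiltedSum_term_nonneg hQ.1 (fun x => (hW x).1) hv ρ z) hpos.le, ?_⟩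
  simp only [tiltedDist, ← Finset.sum_div]
  exact div_self hpos.ne'

theorem tiltedDist_eq_zero {ρ : ℝ} {z : X × Y} (hz : joint Q W z = 0) :
    tiltedDist W Q v ρ z = 0 := by
  simp [tiltedDist, hz]

theorem margY_tiltedDist_eq_zero (hQ : ∀ x, 0 ≤ Q x) (hv : ∀ x y, 0 ≤ v x y)
    (hvJ : ∀ z : X × Y, v z.1 z.2 = 0 → joint Q W z = 0) (ρ : ℝ) {y : Y}
    (hy : avgMetric Q v y = 0) : margY (tiltedDist W Q v ρ) y = 0 :=
  Finset.sum_eq_zero fun x _ => tiltedDist_eq_zero <| by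
    by_contra h
    exact (avgMetric_pos_of_joint_ne_zero hQ hv hvJ h).ne' hy

theorem margY_tiltedDist' (hQ : ∀ x, 0 ≤ Q x) (hv : ∀ x y, 0 ≤ v x y)
    (hvJ : ∀ z : X × Y, v z.1 z.2 = 0 → joint Q W z = 0) (ρ : ℝ) :
    margY (tiltedDist' W Q v ρ) = margY (tiltedDist W Q v ρ) := by
  ext y
  set N := margY (tiltedDist W Q v ρ) with hN
  by_cases hy : avgMetric Q v y = 0
  · rw [hN, margY_tiltedDist_eq_zero hQ hv hvJ ρ hy, margY]
    simp [tiltedDist', hy]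
  · calc margY (tiltedDist' W Q v ρ) y = N y / avgMetric Q v y * avgMetric Q v y := by
          rw [avgMetric, Finset.mul_sum, margY]
          refine Finset.sum_congr rfl fun x _ => ?_
          simp only [tiltedDist', prodDist, avgMetric, ← hN]
          ring
      _ = N y := div_mul_cancel₀ _ hy

theorem tiltedDist'_mem_stdSimplex (hQ : Q ∈ stdSimplex ℝ X) (hW : ∀ x, W x ∈ stdSimplex ℝ Y)
    (hv : ∀ x y, 0 ≤ v x y) (hvJ : ∀ z : X × Y, v z.1 z.2 = 0 → joint Q W z = 0) (ρ : ℝ) :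
    tiltedDist' W Q v ρ ∈ stdSimplex ℝ (X × Y) := by
  have hN := margY_mem_stdSimplex (tiltedDist_mem_stdSimplex hQ hW hv hvJ ρ)
  refine ⟨fun z => mul_nonneg (mul_nonneg (hQ.1 _) (hN.1 _))
    (div_nonneg (hv _ _) (avgMetric_nonneg hQ.1 hv _)), ?_⟩
  rw [← hN.2, ← margY_tiltedDist' hQ.1 hv hvJ ρ, Fintype.sum_prod_type_right]
  rfl

/-- The value of the Lagrangian at its minimizer is the exponent functional. -/
theorem lagrangian_tiltedDist (hQ : Q ∈ stdSimplex ℝ X) (hW : ∀ x, W x ∈ stdSimplex ℝ Y)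
    (hv : ∀ x y, 0 ≤ v x y) (hvJ : ∀ z : X × Y, v z.1 z.2 = 0 → joint Q W z = 0) (ρ : ℝ) :
    klSum (tiltedDist W Q v ρ) (joint Q W)
        + ρ * klSum (tiltedDist' W Q v ρ) (prodDist Q (margY (tiltedDist W Q v ρ)))
        + ρ * (∑ z, tiltedDist W Q v ρ z * Real.log (v z.1 z.2)
          - ∑ z, tiltedDist' W Q v ρ z * Real.log (v z.1 z.2))
      = -Real.log (tiltedSum W Q v ρ) := by
  have hpos := tiltedSum_pos hQ hW hv hvJ ρ
  have hP := tiltedDist_mem_stdSimplex hQ hW hv hvJ ρ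
  set P := tiltedDist W Q v ρ with hPdef
  set P' := tiltedDist' W Q v ρ with hPdef'
  have hY : margY P' = margY P := margY_tiltedDist' hQ.1 hv hvJ ρ
  have e1 : klSum P (joint Q W) = ρ * (∑ z, P z * Real.log (avgMetric Q v z.2)
      - ∑ z, P z * Real.log (v z.1 z.2)) - Real.log (tiltedSum W Q v ρ) := by
    rw [← one_mul (Real.log (tiltedSum W Q v ρ)), ← hP.2, Finset.sum_mul, klSum,
      ← Finset.sum_sub_distrib, Finset.mul_sum, ← Finset.sum_sub_distrib]
    refine Finset.sum_congr rfl fun z _ => ?_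
    by_cases hz : joint Q W z = 0
    · simp [hPdef, tiltedDist_eq_zero hz]
    have hne := right_ne_zero_of_mul (tiltedSum_term_pos hQ.1 (fun x => (hW x).1) hv hvJ ρ hz).ne'
    have : P z / joint Q W z
        = (avgMetric Q v z.2 / v z.1 z.2) ^ ρ / tiltedSum W Q v ρ := by
      rw [hPdef, tiltedDist]
      field_simp
    rw [this, Real.log_div hne hpos.ne', log_avgMetric_div_rpow hQ.1 hv hvJ ρ hz]
    ring
  have e2 : klSum P' (prodDist Q (margY P))
      = ∑ z, P' z * Real.log (v z.1 z.2) - ∑ z, P' z * Real.log (avgMetric Q v z.2) := by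
    rw [klSum, ← Finset.sum_sub_distrib]
    refine Finset.sum_congr rfl fun z _ => ?_
    by_cases hz : P' z = 0
    · simp [hz]
    have hz2 : prodDist Q (margY P) z * (v z.1 z.2 / avgMetric Q v z.2) ≠ 0 := hz
    have hp := left_ne_zero_of_mul hz2
    have hr := right_ne_zero_of_mul hz2
    have hv0 : v z.1 z.2 ≠ 0 := fun h => hr (by simp [h])
    have hA0 : avgMetric Q v z.2 ≠ 0 := fun h => hr (by simp [h])
    have : P' z / prodDist Q (margY P) z = v z.1 z.2 / avgMetric Q v z.2 := by
      change prodDist Q (margY P) z * (v z.1 z.2 / avgMetric Q v z.2) / _ = _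
      field_simp
    rw [this, Real.log_div hv0 hA0]
    ring
  rw [e1, e2, sum_mul_log_avgMetric_eq hY fun y => Real.log (avgMetric Q v y)]
  ring

end Gibbs

section E0

variable {W q : X → Y → ℝ} {Q : X → ℝ}

theorem E0Obj_eq (hQ : Q ∈ stdSimplex ℝ X) (hW : ∀ x, W x ∈ stdSimplex ℝ Y)
    (hq : ∀ x y, 0 ≤ q x y) {ρ : ℝ} (hρ : 0 ≤ ρ) {s : ℝ} {a : X → ℝ}
    (h : ∀ z : X × Y, tiltedMetric q s a z.1 z.2 = 0 → joint Q W z = 0) :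
    E0Obj W q Q ρ s a = ((-Real.log (tiltedSum W Q (tiltedMetric q s a) ρ) : ℝ) : EReal) := by
  have hv := tiltedMetric_nonneg hq s a
  rw [EReal.coe_neg, ← ENNReal.log_ofReal_of_pos (tiltedSum_pos hQ hW hv h ρ), E0Obj,
    ← Fintype.sum_prod_type', tiltedSum,
    ENNReal.ofReal_sum_of_nonneg fun z _ =>
      tiltedSum_term_nonneg hQ.1 (fun x => (hW x).1) hv ρ z]
  congr 2
  refine Finset.sum_congr rfl fun z _ => ?_
  by_cases hz : joint Q W z = 0
  · have hz' : Q z.1 * W z.1 z.2 = 0 := hz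
    simp [hz, hz']
  have hz0 : 0 ≤ joint Q W z := (joint_mem_stdSimplex hQ hW).1 z
  have hne : q z.1 z.2 ^ s ≠ 0 := fun h0 => hz (h z (tiltedMetric_eq_zero_iff.2 h0))
  rw [tiltedRatio, if_neg hne, ENNReal.ofReal_mul hz0, ← ENNReal.ofReal_rpow_of_nonneg _ hρ]
  · rfl
  · exact div_nonneg (avgMetric_nonneg hQ.1 hv _) (hv _ _)

theorem E0Obj_eq_bot (hQ : Q ∈ stdSimplex ℝ X) (hW : ∀ x, W x ∈ stdSimplex ℝ Y)
    {ρ : ℝ} (hρ : 0 < ρ) {s : ℝ} {a : X → ℝ}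
    (h : ¬ ∀ z : X × Y, tiltedMetric q s a z.1 z.2 = 0 → joint Q W z = 0) :
    E0Obj W q Q ρ s a = ⊥ := by
  push Not at h
  obtain ⟨z, hz, hJ⟩ := h
  have hJ0 : 0 < Q z.1 * W z.1 z.2 := lt_of_le_of_ne' ((joint_mem_stdSimplex hQ hW).1 z) hJ
  rw [E0Obj, EReal.neg_eq_bot_iff, ENNReal.log_eq_top_iff, ← Fintype.sum_prod_type',
    ENNReal.sum_eq_top]
  refine ⟨z, Finset.mem_univ _, ?_⟩
  rw [tiltedRatio, if_pos (tiltedMetric_eq_zero_iff.1 hz), ENNReal.top_rpow_of_pos hρ,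
    ENNReal.mul_top]
  exact (ENNReal.ofReal_pos.2 hJ0).ne'

/-- Infinite ratios do no harm, since `⊤ ^ 0 = 1`. -/
theorem E0Obj_zero_rho (hQ : Q ∈ stdSimplex ℝ X) (hW : ∀ x, W x ∈ stdSimplex ℝ Y) (s : ℝ)
    (a : X → ℝ) : E0Obj W q Q 0 s a = 0 := by
  have hJ := joint_mem_stdSimplex hQ hW
  have : ∑ x, ∑ y, ENNReal.ofReal (Q x * W x y) = 1 := by
    rw [← Fintype.sum_prod_type']
    change ∑ z, ENNReal.ofReal (joint Q W z) = 1
    rw [← ENNReal.ofReal_sum_of_nonneg fun z _ => hJ.1 z, hJ.2, ENNReal.ofReal_one]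
  simp [E0Obj, this]

theorem E0Obj_zero_zero (hQ : Q ∈ stdSimplex ℝ X) (hW : ∀ x, W x ∈ stdSimplex ℝ Y) (ρ : ℝ) :
    E0Obj W q Q ρ 0 0 = 0 := by
  rw [← E0Obj_zero_rho (q := q) hQ hW 0 0, E0Obj, E0Obj]
  simp [tiltedRatio, hQ.2]

/-- With s = 0 and no tilt every ratio is 1; ρ = 0 and ρ = 1 give the two values in the maximum. -/
theorem max_zero_neg_le_ErCostPrime (hQ : Q ∈ stdSimplex ℝ X) (hW : ∀ x, W x ∈ stdSimplex ℝ Y)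
    (R : ℝ) : ((max 0 (-R) : ℝ) : EReal) ≤ ErCostPrime W q Q R 0 := by
  have key : ∀ ρ ∈ Set.Icc (0 : ℝ) 1, ((-(ρ * R) : ℝ) : EReal) ≤ ErCostPrime W q Q R 0 := by
    intro ρ hρ
    refine le_iSup₂_of_le ρ hρ ?_
    rw [EReal.coe_neg, ← zero_sub]
    refine EReal.sub_le_sub ?_ le_rfl
    rw [← E0Obj_zero_zero (q := q) hQ hW ρ]
    exact le_iSup₂_of_le 0 Set.self_mem_Ici le_rfl
  rcases max_cases 0 (-R) with ⟨h, _⟩ | ⟨h, _⟩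
  · rw [h]
    simpa using key 0 (by simp)
  · rw [h]
    simpa using key 1 (by simp)

/-- Weak duality for the exponent functional. -/
theorem E0Obj_le (hQ : Q ∈ stdSimplex ℝ X) (hW : ∀ x, W x ∈ stdSimplex ℝ Y)
    (hq : ∀ x y, 0 ≤ q x y) {ρ : ℝ} (hρ : 0 ≤ ρ) {s : ℝ} (hs : 0 ≤ s) (a : X → ℝ)
    {P P' : X × Y → ℝ} (hP : P ∈ stdSimplex ℝ (X × Y)) (hP' : P' ∈ stdSimplex ℝ (X × Y))
    (hX : margX P' = margX P) (hY : margY P' = margY P)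
    (hle : expLog P (fun z => q z.1 z.2) ≤ expLog P' (fun z => q z.1 z.2))
    (hPJ : ∀ z, joint Q W z = 0 → P z = 0) (hPQ : ∀ z : X × Y, Q z.1 = 0 → P' z = 0) :
    E0Obj W q Q ρ s a
      ≤ ((klSum P (joint Q W) + ρ * klSum P' (prodDist Q (margY P)) : ℝ) : EReal) := by
  rcases hρ.eq_or_lt with rfl | hρ'
  · rw [E0Obj_zero_rho hQ hW, zero_mul, add_zero]
    exact_mod_cast klSum_nonneg hP (joint_mem_stdSimplex hQ hW) hPJ
  by_cases h : ∀ z : X × Y, tiltedMetric q s a z.1 z.2 = 0 → joint Q W z = 0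
  swap
  · rw [E0Obj_eq_bot hQ hW hρ' h]
    exact bot_le
  have hPv : ∀ z : X × Y, tiltedMetric q s a z.1 z.2 = 0 → P z = 0 := fun z hz => hPJ z (h z hz)
  have hsq : s ≠ 0 → ∀ z : X × Y, q z.1 z.2 = 0 → tiltedMetric q s a z.1 z.2 = 0 :=
    fun hs0 z hz => tiltedMetric_eq_zero_iff.2 (by rw [hz, Real.zero_rpow hs0])
  -- The expectation under P is finite, so the metric inequality forbids −∞ under P'.
  have hPq' : s ≠ 0 → ∀ z : X × Y, q z.1 z.2 = 0 → P' z = 0 := fun hs0 z hz => by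
    by_contra hne
    rw [expLog_eq_bot (P := P') ⟨z, hne, hz⟩,
      expLog_eq_coe fun z hz => hPv z (hsq hs0 z hz)] at hle
    exact absurd (le_bot_iff.mp hle) (EReal.coe_ne_bot _)
  have hPv' : ∀ z : X × Y, tiltedMetric q s a z.1 z.2 = 0 → P' z = 0 := fun z hz => by
    have h1 : q z.1 z.2 ^ s = 0 := tiltedMetric_eq_zero_iff.1 hz
    have h2 := (Real.rpow_eq_zero_iff_of_nonneg (hq _ _)).1 h1
    exact hPq' h2.2 z h2.1
  have hsum : ∀ N : X × Y → ℝ, (∀ z : X × Y, tiltedMetric q s a z.1 z.2 = 0 → N z = 0) →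
      ∑ z, N z * Real.log (tiltedMetric q s a z.1 z.2)
        = s * ∑ z, N z * Real.log (q z.1 z.2) + ∑ z, N z * a z.1 := fun N hN => by
    rw [Finset.mul_sum, ← Finset.sum_add_distrib]
    refine Finset.sum_congr rfl fun z _ => ?_
    by_cases hz : N z = 0
    · simp [hz]
    · rw [log_tiltedMetric hq (mt (hN z) hz)]
      ring
  rw [E0Obj_eq hQ hW hq hρ h, EReal.coe_le_coe_iff]
  refine neg_log_tiltedSum_le hQ hW (tiltedMetric_nonneg hq s a) h hρ hP hP' hY hPJ hPQ hPv' ?_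
  rw [hsum P hPv, hsum P' hPv', sum_mul_fst, sum_mul_fst, hX]
  refine add_le_add ?_ le_rfl
  rcases eq_or_ne s 0 with rfl | hs0
  · simp
  · refine mul_le_mul_of_nonneg_left ?_ hs
    rw [expLog_eq_coe fun z hz => hPv z (hsq hs0 z hz), expLog_eq_coe (hPq' hs0),
      EReal.coe_le_coe_iff] at hle
    exact hle

/-- The tilt drops out because P and P' have the same X-marginal, and ρx ≤ [x]⁺ for ρ ∈ [0,1]. -/
theorem ErCostPrime_le_ErCC (hQ : Q ∈ stdSimplex ℝ X) (hW : ∀ x, W x ∈ stdSimplex ℝ Y)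
    (hq : ∀ x y, 0 ≤ q x y) (R : ℝ) (a : X → ℝ) : ErCostPrime W q Q R a ≤ ErCC W q Q R := by
  refine le_ErCC fun P P' ⟨hP, hP', hX, hX', hY, hle⟩ => ?_
  by_cases htop : costObj W Q R P P' = ⊤
  · rw [htop]
    exact le_top
  obtain ⟨h1, h2⟩ := not_not.mp (mt (costObj_eq_top R) htop)
  rw [costObj_eq_coe R h1 h2, costObjReal]
  refine iSup₂_le fun ρ hρ => ?_
  have h3 : E0CostPrime W q Q ρ a
      ≤ ((klSum P (joint Q W) + ρ * klSum P' (prodDist Q (margY P)) : ℝ) : EReal) :=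
    iSup₂_le fun s hs => E0Obj_le hQ hW hq hρ.1 hs a hP hP' (hX'.trans hX.symm) hY hle h1
      fun z hz => h2 z (by simp [prodDist, hz])
  refine (EReal.sub_le_sub h3 le_rfl).trans ?_
  rw [← EReal.coe_sub, EReal.coe_le_coe_iff]
  have := mul_le_max_zero (x := klSum P' (prodDist Q (margY P)) - R) hρ.1 hρ.2
  linarith

end E0

end

end MismatchedDecoding

namespace MismatchedDecoding

set_option linter.unusedSectionVars false

noncomputable section

variable {X Y Z : Type*} [Fintype X] [Fintype Y] [Fintype Z]

/-! ### Maximum likelihood: tilting does not improve the i.i.d. exponent -/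

section MaximumLikelihood

variable {W : X → Y → ℝ} {Q : X → ℝ}

/-- Since W = v^(1+ρ), the weight W·(A/v)^ρ equals v·A^ρ with A = E_Q[v]. The conditional law of X
given y is then Q·v/A, exactly the one used to build `tiltedDist'`. -/
theorem tiltedDist'_eq_of_maximumLikelihood (hQ : Q ∈ stdSimplex ℝ X)
    {v : X → Y → ℝ} (hv : ∀ x y, 0 ≤ v x y) {ρ : ℝ}
    (hρ : 0 ≤ ρ) (hvW : ∀ x y, v x y ^ (1 + ρ) = W x y) :
    tiltedDist' W Q v ρ = tiltedDist W Q v ρ := by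
  have hA := avgMetric_nonneg hQ.1 hv
  have hP : ∀ z : X × Y, tiltedDist W Q v ρ z
      = Q z.1 * v z.1 z.2 * (avgMetric Q v z.2 ^ ρ / tiltedSum W Q v ρ) := by
    intro z
    rw [tiltedDist, joint, ← hvW]
    rcases (hv z.1 z.2).eq_or_lt with h | h
    · rw [← h, Real.zero_rpow (by positivity)]
      simp
    · rw [Real.rpow_add h, Real.rpow_one, Real.div_rpow (hA _) h.le]
      have := (Real.rpow_pos_of_pos h ρ).ne'
      field_simp
  have hN : ∀ y, margY (tiltedDist W Q v ρ) y
      = avgMetric Q v y * (avgMetric Q v y ^ ρ / tiltedSum W Q v ρ) := by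
    intro y
    simp only [margY, hP, ← Finset.sum_mul]
    rfl
  ext z
  rw [tiltedDist', prodDist, hN, hP]
  by_cases hz : avgMetric Q v z.2 = 0
  · have : Q z.1 * v z.1 z.2 = 0 :=
      (Finset.sum_eq_zero_iff_of_nonneg fun x _ => mul_nonneg (hQ.1 x) (hv x z.2)).mp hz z.1
        (Finset.mem_univ _)
    simp [hz, this]
  · field_simp

/-- For maximum-likelihood decoding, the choice `s = 1 / (1 + ρ)` without tilting is optimal. -/
theorem E0Obj_le_of_maximumLikelihood (hQ : Q ∈ stdSimplex ℝ X)
    (hW : ∀ x, W x ∈ stdSimplex ℝ Y) {ρ : ℝ} (hρ : 0 ≤ ρ) {s : ℝ} (hs : 0 ≤ s) (a : X → ℝ) :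
    E0Obj W W Q ρ s a ≤ E0Obj W W Q ρ (1 / (1 + ρ)) 0 := by
  have hW' : ∀ x y, 0 ≤ W x y := fun x => (hW x).1
  set v := tiltedMetric W (1 / (1 + ρ)) 0 with hvdef
  have hv : ∀ x y, 0 ≤ v x y := tiltedMetric_nonneg hW' _ _
  have hvW : ∀ x y, v x y ^ (1 + ρ) = W x y := fun x y => by
    have : 1 + ρ ≠ 0 := by positivity
    rw [hvdef, tiltedMetric, Pi.zero_apply, Real.exp_zero, mul_one, ← Real.rpow_mul (hW' x y),
      one_div_mul_cancel this, Real.rpow_one]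
  have hvJ : ∀ z : X × Y, v z.1 z.2 = 0 → joint Q W z = 0 := fun z hz =>
    joint_eq_zero_of_channel_eq_zero W Q z (by
      rw [← hvW, hz, Real.zero_rpow (by positivity)])
  have hP := tiltedDist_mem_stdSimplex hQ hW hv hvJ ρ
  have h1 := lagrangian_tiltedDist hQ hW hv hvJ ρ
  -- On the diagonal the metric term cancels, so the untilted value is the divergence sum at (P, P),
  -- a feasible pair for weak duality with any s and a.
  rw [tiltedDist'_eq_of_maximumLikelihood hQ hv hρ hvW, sub_self, mul_zero, add_zero] at h1
  rw [E0Obj_eq hQ hW hW' hρ hvJ, ← h1]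
  exact E0Obj_le hQ hW hW' hρ hs a hP hP rfl rfl le_rfl (fun z hz => tiltedDist_eq_zero hz)
    fun z hz => tiltedDist_eq_zero (by simp [joint, hz])

theorem iSup_ErCostPrime_eq_ErIid (hQ : Q ∈ stdSimplex ℝ X) (hW : ∀ x, W x ∈ stdSimplex ℝ Y)
    (R : ℝ) : (⨆ a₁ : X → ℝ, ErCostPrime W W Q R a₁) = ErIid W W Q R := by
  refine le_antisymm (iSup_le fun a => iSup₂_mono fun ρ hρ => EReal.sub_le_sub ?_ le_rfl)
    (le_iSup_of_le 0 le_rfl)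
  refine iSup₂_le fun s hs => (E0Obj_le_of_maximumLikelihood hQ hW hρ.1 hs a).trans ?_
  exact le_iSup₂_of_le (1 / (1 + ρ))
    (Set.mem_Ici.2 (one_div_nonneg.2 (add_nonneg zero_le_one hρ.1))) le_rfl

end MaximumLikelihood

/-! ### Upper semicontinuity of the constant-composition exponent in Q -/

section UpperSemicontinuity

variable {W q : X → Y → ℝ} {Q : X → ℝ}

/-- `costObj` at pairs with both `X`-marginals equal to `Q`, in entropy form. -/
def entropyObj (W : X → Y → ℝ) (R : ℝ) (k : (X × Y → ℝ) × (X × Y → ℝ)) : ℝ :=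
  ∑ z, k.1 z * Real.log (k.1 z) - ∑ x, margX k.1 x * Real.log (margX k.1 x)
    - ∑ z, k.1 z * Real.log (W z.1 z.2)
    + max 0 (∑ z, k.2 z * Real.log (k.2 z) - ∑ x, margX k.2 x * Real.log (margX k.2 x)
      - ∑ y, margY k.2 y * Real.log (margY k.2 y) - R)

theorem continuous_entropyObj (W : X → Y → ℝ) (R : ℝ) : Continuous (entropyObj W R) := by
  have hX := continuous_margX (X := X) (Y := Y)
  have hY := continuous_margY (X := X) (Y := Y)
  have h1 : ∀ {f : (X × Y → ℝ) × (X × Y → ℝ) → ℝ}, Continuous f →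
      Continuous fun k => f k * Real.log (f k) := fun hf => Real.continuous_mul_log.comp hf
  unfold entropyObj
  refine Continuous.add (Continuous.sub (Continuous.sub ?_ ?_) (by fun_prop))
    (continuous_const.max (Continuous.sub (Continuous.sub (Continuous.sub ?_ ?_) ?_)
      continuous_const))
  all_goals exact continuous_finsetSum _ fun z _ => h1 (by fun_prop)

theorem klSum_margX {P : X × Y → ℝ} (hP : ∀ z, 0 ≤ P z) :
    klSum P (fun z => margX P z.1)
      = ∑ z, P z * Real.log (P z) - ∑ x, margX P x * Real.log (margX P x) := by
  rw [klSum, ← sum_mul_fst, ← Finset.sum_sub_distrib]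
  refine Finset.sum_congr rfl fun z _ => ?_
  by_cases hz : P z = 0
  · simp [hz]
  · rw [Real.log_div hz fun h => hz (eq_zero_of_margX_eq_zero hP h), mul_sub]

theorem costObj_eq_entropyObj (R : ℝ) {P P' : X × Y → ℝ} (hP : ∀ z, 0 ≤ P z)
    (hP' : ∀ z, 0 ≤ P' z) (hX : margX P = Q) (hX' : margX P' = Q) (hY : margY P' = margY P)
    (h : ∀ z, joint Q W z = 0 → P z = 0) :
    costObj W Q R P P' = (entropyObj W R (P, P') : EReal) := by
  have h2 : ∀ z : X × Y, Q z.1 = 0 → P' z = 0 := fun z hz =>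
    eq_zero_of_margX_eq_zero hP' (hX' ▸ hz)
  have h3 : ∀ z, prodDist Q (margY P) z = 0 → P' z = 0 := by
    rw [← hY]
    exact prodDist_eq_zero_imp hP' h2
  rw [costObj_eq_coe R h h3, costObjReal, entropyObj, klSum_joint_eq_sub h, ← hY,
    klSum_prodDist_margY hP' h2]
  nth_rewrite 1 [← hX]
  nth_rewrite 1 [← hX']
  rw [klSum_margX hP, klSum_margX hP']

/-- A common added term preserves the metric order; if the left mixture is not −∞, every expectation
involved is finite. -/
theorem expLog_mix_le {P P' A f : Z → ℝ} (hP : ∀ z, 0 ≤ P z) (hA : ∀ z, 0 ≤ A z) {r : ℝ}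
    (hr : 0 < r) (h : expLog P f ≤ expLog P' f) :
    expLog (fun z => r * P z + A z) f ≤ expLog (fun z => r * P' z + A z) f := by
  by_cases h0 : ∀ z, f z = 0 → r * P z + A z = 0
  · have hPz : ∀ z, f z = 0 → P z = 0 := fun z hz => by
      have := h0 z hz
      have h1 := mul_nonneg hr.le (hP z)
      exact (mul_eq_zero.mp (by linarith [hA z] : r * P z = 0)).resolve_left hr.ne'
    have hAz : ∀ z, f z = 0 → A z = 0 := fun z hz => by
      have := h0 z hz
      rwa [hPz z hz, mul_zero, zero_add] at this
    have hPz' : ∀ z, f z = 0 → P' z = 0 := fun z hz => by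
      by_contra hne
      rw [expLog_eq_bot (P := P') ⟨z, hne, hz⟩, expLog_eq_coe hPz] at h
      exact absurd (le_bot_iff.mp h) (EReal.coe_ne_bot _)
    rw [expLog_eq_coe hPz, expLog_eq_coe hPz', EReal.coe_le_coe_iff] at h
    rw [expLog_eq_coe h0, expLog_eq_coe fun z hz => by rw [hPz' z hz, hAz z hz]; simp,
      EReal.coe_le_coe_iff]
    simp only [add_mul, Finset.sum_add_distrib, mul_assoc, ← Finset.mul_sum]
    exact add_le_add (mul_le_mul_of_nonneg_left h hr.le) le_rfl
  · push Not at h0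
    obtain ⟨z, hz, hne⟩ := h0
    rw [expLog_eq_bot (P := fun z => r * P z + A z) ⟨z, hne, hz⟩]
    exact bot_le

/-- The largest `r` with `r * Q ≤ Q'` and `r ≤ 1`, up to letters outside the support of `Q`. -/
def domRatio [Nonempty X] (Q Q' : X → ℝ) : ℝ :=
  open Classical in
  Finset.univ.inf' Finset.univ_nonempty fun x => if Q x = 0 then 1 else Q' x / Q x

theorem continuous_domRatio [Nonempty X] (Q : X → ℝ) : Continuous (domRatio Q) := by
  classical
  unfold domRatio
  refine Continuous.finset_inf'_apply _ fun x _ => ?_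
  split_ifs
  · exact continuous_const
  · fun_prop

theorem domRatio_self [Nonempty X] (Q : X → ℝ) : domRatio Q Q = 1 := by
  classical
  unfold domRatio
  have : (fun x => if Q x = 0 then (1 : ℝ) else Q x / Q x) = fun _ => 1 := by
    ext x
    split_ifs with h
    · rfl
    · exact div_self h
  rw [this]
  exact Finset.inf'_const _ _

theorem domRatio_mul_le [Nonempty X] {Q Q' : X → ℝ} (hQ : ∀ x, 0 ≤ Q x) (hQ' : ∀ x, 0 ≤ Q' x)
    (x : X) : domRatio Q Q' * Q x ≤ Q' x := by
  classical
  rcases (hQ x).eq_or_lt with h | h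
  · rw [← h, mul_zero]
    exact hQ' x
  · rw [← le_div_iff₀ h]
    have := Finset.inf'_le (fun x => if Q x = 0 then (1 : ℝ) else Q' x / Q x) (Finset.mem_univ x)
    rwa [if_neg h.ne'] at this

/-- A joint distribution with `X`-marginal `Q'` close to `N` when `Q'` is close to `Q = N_X`. -/
def transport [Nonempty X] (W : X → Y → ℝ) (Q : X → ℝ) (N : X × Y → ℝ) (Q' : X → ℝ)
    (z : X × Y) : ℝ :=
  domRatio Q Q' * N z + (Q' z.1 - domRatio Q Q' * Q z.1) * W z.1 z.2

theorem continuous_transport [Nonempty X] (W : X → Y → ℝ) (Q : X → ℝ) (N : X × Y → ℝ) :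
    Continuous (transport W Q N) := by
  have := continuous_domRatio Q
  unfold transport
  fun_prop

theorem transport_self [Nonempty X] (W : X → Y → ℝ) (Q : X → ℝ) (N : X × Y → ℝ) :
    transport W Q N Q = N := by
  ext z
  simp [transport, domRatio_self]

theorem margX_transport [Nonempty X] (hW : ∀ x, W x ∈ stdSimplex ℝ Y) {N : X × Y → ℝ}
    (hN : margX N = Q) (Q' : X → ℝ) : margX (transport W Q N Q') = Q' := by
  ext x
  have : ∑ y, N (x, y) = Q x := congrFun hN x
  simp only [margX, transport, Finset.sum_add_distrib, ← Finset.mul_sum, (hW x).2, this]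
  ring

theorem isCCPair_transport [Nonempty X] (hW : ∀ x, W x ∈ stdSimplex ℝ Y)
    (hQ : Q ∈ stdSimplex ℝ X) {P P' : X × Y → ℝ} (h : IsCCPair q Q P P') {Q' : X → ℝ}
    (hQ' : Q' ∈ stdSimplex ℝ X) (hr : 0 < domRatio Q Q') :
    IsCCPair q Q' (transport W Q P Q') (transport W Q P' Q') := by
  obtain ⟨hP, hP', hX, hX', hY, hle⟩ := h
  have hA : ∀ z : X × Y, 0 ≤ (Q' z.1 - domRatio Q Q' * Q z.1) * W z.1 z.2 := fun z =>
    mul_nonneg (sub_nonneg.2 (domRatio_mul_le hQ.1 hQ'.1 _)) ((hW _).1 _)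
  have hsum : ∀ N : X × Y → ℝ, margX N = Q → ∑ z, transport W Q N Q' z = 1 := fun N hN => by
    rw [Fintype.sum_prod_type, ← hQ'.2]
    exact Finset.sum_congr rfl fun x _ => congrFun (margX_transport hW hN Q') x
  refine ⟨⟨fun z => add_nonneg (mul_nonneg hr.le (hP.1 z)) (hA z), hsum P hX⟩,
    ⟨fun z => add_nonneg (mul_nonneg hr.le (hP'.1 z)) (hA z), hsum P' hX'⟩,
    margX_transport hW hX Q', margX_transport hW hX' Q', ?_, expLog_mix_le hP.1 hA hr hle⟩
  ext y
  have : ∑ x, P' (x, y) = ∑ x, P (x, y) := congrFun hY y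
  simp only [margY, transport, Finset.sum_add_distrib, ← Finset.mul_sum, this]

/-- A pair with value below c at Q is transported to each nearby Q'. Both members receive the same
extra mass, sent through W, which preserves the shared Y-marginal, the metric order and absolute
continuity, and the entropy form of the objective varies continuously. -/
theorem upperSemicontinuousOn_ErCC [Nonempty X] (hW : ∀ x, W x ∈ stdSimplex ℝ Y) (R : ℝ) :
    UpperSemicontinuousOn (fun Q => ErCC W q Q R) (stdSimplex ℝ X) := by
  intro Q hQ c hc
  obtain ⟨P, P', hpair, hlt⟩ := exists_of_ErCC_lt hc
  obtain ⟨h1, -⟩ := not_not.mp (mt (costObj_eq_top R) (ne_top_of_lt hlt))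
  rw [costObj_eq_entropyObj R hpair.1.1 hpair.2.1.1 hpair.2.2.1 hpair.2.2.2.1
    hpair.2.2.2.2.1 h1] at hlt
  have hcont : Continuous fun Q' => (entropyObj W R
      (transport W Q P Q', transport W Q P' Q') : EReal) :=
    continuous_coe_real_ereal.comp ((continuous_entropyObj W R).comp
      ((continuous_transport W Q P).prodMk (continuous_transport W Q P')))
  have hev1 : ∀ᶠ Q' in nhds Q, (entropyObj W R
      (transport W Q P Q', transport W Q P' Q') : EReal) < c :=
    hcont.continuousAt.eventually_lt continuousAt_const (by simpa only [transport_self] using hlt)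
  have hev2 : ∀ᶠ Q' in nhds Q, 0 < domRatio Q Q' :=
    continuousAt_const.eventually_lt (continuous_domRatio Q).continuousAt
      (by rw [domRatio_self]; exact one_pos)
  filter_upwards [self_mem_nhdsWithin, nhdsWithin_le_nhds hev1, nhdsWithin_le_nhds hev2]
    with Q' hQ' hlt' hr
  have hpair' := isCCPair_transport hW hQ hpair hQ' hr
  refine (ErCC_le hpair').trans_lt ?_
  rwa [costObj_eq_entropyObj R hpair'.1.1 hpair'.2.1.1 hpair'.2.2.1 hpair'.2.2.2.1
    hpair'.2.2.2.2.1]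
  intro z hz
  rcases mul_eq_zero.mp hz with h | h
  · exact eq_zero_of_margX_eq_zero hpair'.1.1 (by rw [hpair'.2.2.1, h])
  · simp [transport, h, h1 z (by simp [joint, h])]

end UpperSemicontinuity

end

end MismatchedDecoding

/-! ### Strong duality at a maximizing input distribution -/

namespace MismatchedDecoding

set_option linter.unusedSectionVars false

noncomputable section

variable {X Y Z : Type*} [Fintype X] [Fintype Y] [Fintype Z]

/-- The relative entropy is bounded by the `χ²`-divergence. -/
theorem klSum_le_sum_sq_div {P N : Z → ℝ} (hP : ∀ z, 0 ≤ P z) (hN : ∀ z, 0 ≤ N z)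
    (h : ∀ z, N z = 0 → P z = 0) (hsum : ∑ z, P z = ∑ z, N z) :
    klSum P N ≤ ∑ z, (P z - N z) ^ 2 / N z := by
  have : klSum P N ≤ ∑ z, ((P z - N z) ^ 2 / N z + (P z - N z)) := by
    refine Finset.sum_le_sum fun z _ => ?_
    rcases (hP z).eq_or_lt with hz | hz
    · rw [← hz]
      rcases eq_or_ne (N z) 0 with hn | hn
      · simp [hn]
      · simp [pow_two, hn]
    have hn : 0 < N z := (hN z).lt_of_ne' fun h0 => hz.ne' (h z h0)
    have h1 := mul_le_mul_of_nonneg_left (Real.log_le_sub_one_of_pos (div_pos hz hn)) hz.le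
    refine h1.trans (le_of_eq ?_)
    field_simp
    ring
  rwa [Finset.sum_add_distrib, Finset.sum_sub_distrib, hsum, sub_self, add_zero] at this

variable {W q : X → Y → ℝ} {Q : X → ℝ}

theorem convexOn_costObjReal (hQ : Q ∈ stdSimplex ℝ X) (hW : ∀ x, W x ∈ stdSimplex ℝ Y) (R : ℝ) :
    ConvexOn ℝ (pairSet W q Q) fun k => costObjReal W Q R k.1 k.2 :=
  (pairSet_klSum_fst_convexOn hQ hW).add
    ((convexOn_const 0 (convex_pairSet W q Q)).sup (pairSet_klSum_snd_convexOn hQ R))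

theorem ErCC_lt_top (hQ : Q ∈ stdSimplex ℝ X) (hW : ∀ x, W x ∈ stdSimplex ℝ Y) (R : ℝ) :
    ErCC W q Q R < ⊤ := by
  have hJ := joint_mem_stdSimplex hQ hW
  have hX := margX_joint (Q := Q) hW
  refine (ErCC_le ⟨hJ, hJ, hX, hX, rfl, le_rfl⟩).trans_lt ?_
  rw [costObj_eq_entropyObj R hJ.1 hJ.1 hX hX rfl fun _ h => h]
  exact EReal.coe_lt_top _

/-- Replacing the reference input distribution `margX P` by `Q` costs at most twice the relative
entropy between them. -/
theorem costObjReal_le_add (hQ : Q ∈ stdSimplex ℝ X) (R : ℝ) {P P' : X × Y → ℝ}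
    (hP : P ∈ stdSimplex ℝ (X × Y)) (hP' : P' ∈ stdSimplex ℝ (X × Y))
    (hX : margX P' = margX P) (hPJ : ∀ z, joint Q W z = 0 → P z = 0)
    (hPJ' : ∀ z, prodDist Q (margY P) z = 0 → P' z = 0) :
    costObjReal W Q R P P' ≤ costObjReal W (margX P) R P P' + 2 * klSum (margX P) Q := by
  have h1 := klSum_joint_eq_add hP.1 hPJ
  have h2 : klSum P' (prodDist Q (margY P))
      = klSum P' (prodDist (margX P) (margY P)) + klSum (margX P) Q := by
    have := klSum_joint_eq_add (W := fun _ => margY P) hP'.1 hPJ'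
    rwa [hX] at this
  have h3 : 0 ≤ klSum (margX P) Q := klSum_nonneg (margX_mem_stdSimplex hP) hQ fun x hx =>
    Finset.sum_eq_zero fun y _ => hPJ (x, y) (by simp [joint, hx])
  rw [costObjReal, costObjReal, h1, h2]
  have h4 : max 0 (klSum P' (prodDist (margX P) (margY P)) + klSum (margX P) Q - R)
      ≤ max 0 (klSum P' (prodDist (margX P) (margY P)) - R) + klSum (margX P) Q := by
    refine max_le (add_nonneg (le_max_left _ _) h3) ?_
    have := le_max_right 0 (klSum P' (prodDist (margX P) (margY P)) - R)
    linarith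
  linarith

/-- At a maximizer `Q` of the constant-composition exponent, the composition constraint
`P_X = P'_X = Q` may be relaxed to `P_X = P'_X`. -/
theorem ErCC_le_costObjReal_of_isMaxOn (hW : ∀ x, W x ∈ stdSimplex ℝ Y)
    (hQ : Q ∈ stdSimplex ℝ X) {R : ℝ} (hq : ∀ z : X × Y, q z.1 z.2 = 0 → joint Q W z = 0)
    (hmax : IsMaxOn (fun Q => ErCC W q Q R) (stdSimplex ℝ X) Q)
    {k₁ : (X × Y → ℝ) × (X × Y → ℝ)} (hk₁ : k₁ ∈ pairSet W q Q)
    (hX₁ : margX k₁.2 = margX k₁.1) (hgap₁ : 0 ≤ logGap q k₁) :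
    ErCC W q Q R ≤ (costObjReal W Q R k₁.1 k₁.2 : EReal) := by
  obtain ⟨m, hm⟩ : ∃ m : ℝ, ErCC W q Q R = (m : EReal) := by
    refine ⟨(ErCC W q Q R).toReal, (EReal.coe_toReal (ErCC_lt_top hQ hW R).ne ?_).symm⟩
    refine ne_bot_of_le_ne_bot (EReal.coe_ne_bot (max 0 (-R))) (le_ErCC fun P P' h => ?_)
    exact max_zero_neg_le_costObj hW hQ R h.1 h.2.1
  set Q₁ := margX k₁.1 with hQ₁
  have hQ₁mem : Q₁ ∈ stdSimplex ℝ X := margX_mem_stdSimplex hk₁.1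
  have hQ₁zero : ∀ x, Q x = 0 → Q₁ x = 0 := fun x hx =>
    Finset.sum_eq_zero fun y _ => hk₁.2.2.2.1 (x, y) (by simp [joint, hx])
  set V := costObjReal W Q R k₁.1 k₁.2 with hV
  set χ := ∑ x, (Q x - Q₁ x) ^ 2 / Q x with hχ
  -- The segment from Q₁ to Q is prolonged beyond Q, so that Q = (Q_t + t Q₁)/(1+t).
  let Qt : ℝ → X → ℝ := fun t x => Q x + t * (Q x - Q₁ x)
  have hpos : ∀ᶠ t in nhdsWithin (0 : ℝ) (Set.Ioi 0), ∀ x, 0 ≤ Qt t x := by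
    refine nhdsWithin_le_nhds (Filter.eventually_all.2 fun x => ?_)
    rcases (hQ.1 x).eq_or_lt with hx | hx
    · refine Filter.Eventually.of_forall fun t => ?_
      simp [Qt, ← hx, hQ₁zero x hx.symm]
    · have hc : Continuous fun t => Qt t x := by fun_prop
      have : (0 : ℝ) < Qt 0 x := by simpa [Qt] using hx
      exact (continuousAt_const.eventually_lt hc.continuousAt this).mono fun t ht => ht.le
  have key : ∀ᶠ t in nhdsWithin (0 : ℝ) (Set.Ioi 0), m ≤ V + t * (1 + 2 * χ) := by
    filter_upwards [hpos, self_mem_nhdsWithin] with t ht ht0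
    have ht0 : 0 < t := ht0
    have hQt : Qt t ∈ stdSimplex ℝ X := by
      refine ⟨ht, ?_⟩
      simp only [Qt, Finset.sum_add_distrib, ← Finset.mul_sum, Finset.sum_sub_distrib, hQ.2,
        hQ₁mem.2]
      ring
    have hQtzero : ∀ x, Q x = 0 → Qt t x = 0 := fun x hx => by
      simp [Qt, hx, hQ₁zero x hx]
    have hJt : ∀ z, joint Q W z = 0 → joint (Qt t) W z = 0 := fun z hz => by
      rcases mul_eq_zero.mp hz with h | h
      · simp [joint, hQtzero _ h]
      · simp [joint, h]
    -- Maximality bounds the exponent at Q_t by m. The slack t² only selects a near-optimal pair;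
    -- like the divergence of Q_t from Q, at most t²χ, it is negligible after division by t.
    have hlt : ErCC W q (Qt t) R < ((m + t ^ 2 : ℝ) : EReal) := by
      have h1 : ErCC W q (Qt t) R ≤ ErCC W q Q R := hmax hQt
      rw [hm] at h1
      refine h1.trans_lt ?_
      exact_mod_cast lt_add_of_pos_right m (by positivity)
    obtain ⟨P, P', ⟨hP, hP', hX, hX', hY, hle⟩, hobj⟩ := exists_of_ErCC_lt hlt
    obtain ⟨hk, hgap⟩ := mem_pairSet_of_costObj_ne_top (fun z hz => hJt z (hq z hz)) hP hP' hY hle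
      (ne_top_of_lt hobj)
    rw [costObj_eq_coe_of_mem_pairSet R hk, EReal.coe_lt_coe_iff] at hobj
    have hkQ : (P, P') ∈ pairSet W q Q :=
      ⟨hP, hP', hY, fun z hz => hk.2.2.2.1 z (hJt z hz),
        fun z hz => hk.2.2.2.2.1 z (hQtzero _ hz), hk.2.2.2.2.2⟩
    have hkl : klSum (margX P) Q ≤ t ^ 2 * χ := by
      rw [hX]
      refine (klSum_le_sum_sq_div ht hQ.1 hQtzero (hQt.2.trans hQ.2.symm)).trans (le_of_eq ?_)
      rw [hχ, Finset.mul_sum]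
      refine Finset.sum_congr rfl fun x _ => ?_
      simp only [Qt]
      ring
    have hupper := costObjReal_le_add (W := W) hQ R hP hP' (hX'.trans hX.symm) hkQ.2.2.2.1
      (prodDist_imp_of_mem_pairSet hkQ)
    rw [hX] at hupper hkl
    have h1t : 0 < 1 + t := by linarith
    have w1 : 0 ≤ 1 / (1 + t) := by positivity
    have w2 : 0 ≤ t / (1 + t) := by positivity
    have w3 : 1 / (1 + t) + t / (1 + t) = 1 := by field_simp
    have hmix := convex_pairSet W q Q hkQ hk₁ w1 w2 w3
    have hconv := (convexOn_costObjReal (q := q) hQ hW R).2 hkQ hk₁ w1 w2 w3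
    have hmixX : (1 / (1 + t)) • Qt t + (t / (1 + t)) • Q₁ = Q := by
      ext x
      simp only [Qt, Pi.add_apply, Pi.smul_apply, smul_eq_mul]
      field_simp
      ring
    have hmixgap : 0 ≤ logGap q ((1 / (1 + t)) • (P, P') + (t / (1 + t)) • k₁) := by
      rw [map_add, map_smul, map_smul]
      exact add_nonneg (mul_nonneg w1 hgap) (mul_nonneg w2 hgap₁)
    have hlow := ErCC_le (W := W) (R := R) (q := q) (Q := Q) ⟨hmix.1, hmix.2.1, by
        rw [Prod.fst_add, Prod.smul_fst, Prod.smul_fst, margX_add_smul, hX, ← hQ₁, hmixX], by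
        rw [Prod.snd_add, Prod.smul_snd, Prod.smul_snd, margX_add_smul, hX', hX₁, hmixX],
      hmix.2.2.1, (expLog_le_iff_logGap hq hmix).2 hmixgap⟩
    rw [hm, costObj_eq_coe_of_mem_pairSet R hmix, EReal.coe_le_coe_iff] at hlow
    -- The mixture has composition Q, so its value is at least m; convexity bounds that value by the
    -- average of the near-optimal one and V. The zeroth-order terms cancel, leaving m ≤ V + O(t).
    have hfin : m ≤ 1 / (1 + t) * (m + t ^ 2 + 2 * (t ^ 2 * χ)) + t / (1 + t) * V := by
      refine (hlow.trans hconv).trans (add_le_add (mul_le_mul_of_nonneg_left ?_ w1) le_rfl)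
      simp only
      linarith
    have hfin' : (1 + t) * m ≤ m + t ^ 2 + 2 * (t ^ 2 * χ) + t * V := by
      have := mul_le_mul_of_nonneg_left hfin h1t.le
      refine this.trans (le_of_eq ?_)
      field_simp
    refine le_of_mul_le_mul_left ?_ ht0
    linarith
  rw [hm, EReal.coe_le_coe_iff]
  refine ge_of_tendsto (x := nhdsWithin (0 : ℝ) (Set.Ioi 0)) ?_ key
  have hc : Continuous fun t : ℝ => V + t * (1 + 2 * χ) := by fun_prop
  have := hc.tendsto 0
  rw [zero_mul, add_zero] at this
  exact this.mono_left nhdsWithin_le_nhds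

/-- Strong duality at a maximizer of the constant-composition exponent. -/
theorem exists_cost_le_ErCostPrime (hW : ∀ x, W x ∈ stdSimplex ℝ Y) (hqn : ∀ x y, 0 ≤ q x y)
    (hQ : Q ∈ stdSimplex ℝ X) {R : ℝ} (hq : ∀ z : X × Y, q z.1 z.2 = 0 → joint Q W z = 0)
    (hmax : IsMaxOn (fun Q => ErCC W q Q R) (stdSimplex ℝ X) Q) {c : ℝ}
    (hc : (c : EReal) < ErCC W q Q R) :
    ∃ a : X → ℝ, (c : EReal) ≤ ErCostPrime W q Q R a := by
  -- Only P_X − P'_X is constrained, so a single multiplier l acts on both distributions with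
  -- opposite signs, as one tilt does.
  obtain ⟨ρ, s, l, hρ, hρ1, hs, hl⟩ := exists_lagrange_multipliers (isCompact_pairSet W q Q)
    (convex_pairSet W q Q) pairSet_klSum_fst_continuousOn (pairSet_klSum_snd_continuousOn R)
    (pairSet_klSum_fst_convexOn hQ hW) (pairSet_klSum_snd_convexOn hQ R) (logGap q)
    ((margXL X Y).comp (ContinuousLinearMap.fst ℝ _ _ - ContinuousLinearMap.snd ℝ _ _)) 0
    (c := c) (by
      intro k hk hgap hGk
      have hX : margX k.2 = margX k.1 := by
        rw [ContinuousLinearMap.comp_apply, sub_apply, map_sub, sub_eq_zero] at hGk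
        simpa using hGk.symm
      have := hc.trans_le (ErCC_le_costObjReal_of_isMaxOn hW hQ hq hmax hk hX hgap)
      exact_mod_cast this)
  -- Dividing the multipliers by ρ puts the Lagrangian in tilted form; since s/ρ > 0, the tilted
  -- metric has the same zeros as q.
  have hs' : 0 < s / ρ := div_pos hs hρ
  let a : X → ℝ := fun x => l x / ρ
  set v := tiltedMetric q (s / ρ) a with hvdef
  have hv : ∀ x y, 0 ≤ v x y := tiltedMetric_nonneg hqn _ _
  have hvq : ∀ z : X × Y, v z.1 z.2 = 0 ↔ q z.1 z.2 = 0 := fun z => by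
    rw [hvdef, tiltedMetric_eq_zero_iff, Real.rpow_eq_zero (hqn _ _) hs'.ne']
  have hvJ : ∀ z : X × Y, v z.1 z.2 = 0 → joint Q W z = 0 := fun z hz => hq z ((hvq z).1 hz)
  -- It is enough to evaluate the Lagrangian bound at its explicit minimizer, where the value is
  -- −log `tiltedSum` − ρR.
  have hk : (tiltedDist W Q v ρ, tiltedDist' W Q v ρ) ∈ pairSet W q Q :=
    ⟨tiltedDist_mem_stdSimplex hQ hW hv hvJ ρ, tiltedDist'_mem_stdSimplex hQ hW hv hvJ ρ,
      margY_tiltedDist' hQ.1 hv hvJ ρ, fun z hz => tiltedDist_eq_zero hz,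
      fun z hz => by simp [tiltedDist', prodDist, hz],
      fun z hz => by simp [tiltedDist', (hvq z).2 hz]⟩
  have hL := hl _ hk
  have hval := lagrangian_tiltedDist hQ hW hv hvJ ρ
  set P := tiltedDist W Q v ρ
  set P' := tiltedDist' W Q v ρ
  have hlogsum : ∀ N : X × Y → ℝ, (∀ z : X × Y, q z.1 z.2 = 0 → N z = 0) →
      ρ * ∑ z, N z * Real.log (v z.1 z.2)
        = s * ∑ z, N z * Real.log (q z.1 z.2) + ∑ x, l x * margX N x := fun N hN => by
    have : ∑ x, l x * margX N x = ∑ z, N z * l z.1 := by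
      rw [sum_mul_fst]
      exact Finset.sum_congr rfl fun x _ => mul_comm _ _
    rw [this, Finset.mul_sum, Finset.mul_sum, ← Finset.sum_add_distrib]
    refine Finset.sum_congr rfl fun z _ => ?_
    by_cases hz : N z = 0
    · simp [hz]
    · have hv0 : v z.1 z.2 ≠ 0 := fun h0 => hz (hN z ((hvq z).1 h0))
      rw [hvdef, log_tiltedMetric hqn hv0]
      simp only [a]
      field_simp
  have e1 := hlogsum P fun z hz => hk.2.2.2.1 z (hq z hz)
  have e2 := hlogsum P' hk.2.2.2.2.2
  have e3 : ∑ i, l i * (((margXL X Y).comp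
      (ContinuousLinearMap.fst ℝ _ _ - ContinuousLinearMap.snd ℝ _ _)) (P, P') i - (0 : X → ℝ) i)
      = ∑ x, l x * margX P x - ∑ x, l x * margX P' x := by
    rw [← Finset.sum_sub_distrib]
    refine Finset.sum_congr rfl fun x _ => ?_
    rw [ContinuousLinearMap.comp_apply, sub_apply, map_sub]
    simp [mul_sub]
  rw [e3, logGap_apply] at hL
  refine ⟨a, le_iSup₂_of_le ρ ⟨hρ.le, hρ1⟩ ?_⟩
  have h1 : ((-Real.log (tiltedSum W Q v ρ) : ℝ) : EReal) ≤ E0CostPrime W q Q ρ a := by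
    rw [hvdef, ← E0Obj_eq hQ hW hqn hρ.le hvJ]
    exact le_iSup₂_of_le (s / ρ) hs'.le le_rfl
  refine le_trans ?_ (EReal.sub_le_sub h1 le_rfl)
  rw [← EReal.coe_sub, EReal.coe_le_coe_iff]
  simp only at hL
  linarith

theorem iSup_ErCostPrime_eq_ErCC_of_isMaxOn (hW : ∀ x, W x ∈ stdSimplex ℝ Y)
    (hqn : ∀ x y, 0 ≤ q x y) (hQ : Q ∈ stdSimplex ℝ X) {R : ℝ}
    (hmax : IsMaxOn (fun Q => ErCC W q Q R) (stdSimplex ℝ X) Q) :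
    (⨆ a₁ : X → ℝ, ErCostPrime W q Q R a₁) = ErCC W q Q R := by
  refine le_antisymm (iSup_le fun a => ErCostPrime_le_ErCC hQ hW hqn R a) ?_
  by_cases hq : ∀ z : X × Y, q z.1 z.2 = 0 → joint Q W z = 0
  · refine EReal.ge_of_forall_gt_iff_ge.1 fun c hc => ?_
    obtain ⟨a, h⟩ := exists_cost_le_ErCostPrime hW hqn hQ hq hmax hc
    exact le_iSup_of_le a h
  · exact (ErCC_le_of_metric_eq_zero hW hQ R hq).trans
      (le_iSup_of_le 0 (max_zero_neg_le_ErCostPrime hQ hW R))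

/-- The duality gap closes at a maximizer of the constant-composition exponent; at every other Q
weak duality suffices, so the same Q maximizes both sides. -/
theorem exists_isGreatest_iSup_ErCostPrime_ErCC [Nonempty X] (hW : ∀ x, W x ∈ stdSimplex ℝ Y)
    (hqn : ∀ x y, 0 ≤ q x y) (R : ℝ) :
    ∃ m : EReal,
      IsGreatest ((fun Q => ⨆ a₁ : X → ℝ, ErCostPrime W q Q R a₁) '' stdSimplex ℝ X) m ∧
      IsGreatest ((fun Q => ErCC W q Q R) '' stdSimplex ℝ X) m := by
  classical
  obtain ⟨Q, hQ, hmax⟩ := (upperSemicontinuousOn_ErCC (q := q) hW R).exists_isMaxOn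
    ⟨_, single_mem_stdSimplex ℝ (Classical.arbitrary X)⟩ (isCompact_stdSimplex ℝ X)
  refine ⟨ErCC W q Q R, ⟨⟨Q, hQ, iSup_ErCostPrime_eq_ErCC_of_isMaxOn hW hqn hQ hmax⟩, ?_⟩,
    ⟨Q, hQ, rfl⟩, ?_⟩
  · rintro _ ⟨Q', hQ', rfl⟩
    exact (iSup_le fun a => ErCostPrime_le_ErCC hQ' hW hqn R a).trans (hmax hQ')
  · rintro _ ⟨Q', hQ', rfl⟩
    exact hmax hQ'

end

end MismatchedDecoding

open MismatchedDecoding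
theorem theorem4 {X Y : Type*} [Fintype X] [Nonempty X] [Fintype Y]
    (W : X → Y → ℝ) (hW : ∀ x, W x ∈ stdSimplex ℝ Y) (R : ℝ) :
    -- any decoding metric
    (∀ q : X → Y → ℝ, (∀ x y, 0 ≤ q x y) →
      (∀ Q ∈ stdSimplex ℝ X,
        (⨆ (a₁ : X → ℝ) (a₂ : X → ℝ), ErCost W q Q R ![a₁, a₂]) = ErCC W q Q R) ∧
      (∃ m : EReal,
        IsGreatest ((fun Q => ⨆ a₁ : X → ℝ, ErCostPrime W q Q R a₁) '' stdSimplex ℝ X) m ∧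
        IsGreatest ((fun Q => ErCC W q Q R) '' stdSimplex ℝ X) m)) ∧
    -- maximum-likelihood decoding
    (∀ Q ∈ stdSimplex ℝ X,
      (⨆ a₁ : X → ℝ, ErCost W W Q R ![a₁]) = ErCC W W Q R ∧
      (⨆ a₁ : X → ℝ, ErCostPrime W W Q R a₁) = ErIid W W Q R) ∧
    (∃ m : EReal,
      IsGreatest ((fun Q => ErIid W W Q R) '' stdSimplex ℝ X) m ∧
      IsGreatest ((fun Q => ErCC W W Q R) '' stdSimplex ℝ X) m) := by
  refine ⟨fun q hq => ⟨fun Q hQ => iSup_ErCost_two_eq_ErCC hW hQ R,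
    exists_isGreatest_iSup_ErCostPrime_ErCC hW hq R⟩,
    fun Q hQ => ⟨iSup_ErCost_one_eq_ErCC hW hQ R, iSup_ErCostPrime_eq_ErIid hQ hW R⟩, ?_⟩
  obtain ⟨m, h1, h2⟩ := exists_isGreatest_iSup_ErCostPrime_ErCC hW (fun x => (hW x).1) R
  refine ⟨m, ?_, h2⟩
  rwa [Set.image_congr fun Q hQ => iSup_ErCostPrime_eq_ErIid hQ hW R] at h1
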